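/- Let $d\ge 1$ and let $\mathcal F f(\xi)=(2\pi)^{-d/2}\int_{\mathbb R^d}e^{-ix\cdot\xi}f(x)\,dx$, extended to tempered distributions. Fix a nonnegative $\Phi\in C_c^\infty(\mathbb R^d)$ with $$\operatorname{supp}\Phi=\{\xi : 1/2\le|\xi|\le 2\},\qquad \sum_{j\in\mathbb Z}\Phi(2^{-j}\xi)=1\quad(\xi\neq 0).$$ For a Hilbert space $V$ and a $V$-valued tempered distribution $f$ on $\mathbb R^d$ put $$\Delta_j f=\mathcal F^{-1}\big(\Phi(2^{-j}\cdot)\,\mathcal F f\big)\ (j\in\mathbb Z),\qquad S_0 f=\mathcal F^{-1}(\chi\,\mathcal F f),$$ where $\chi(\xi)=\sum_{j\le 0}\Phi(2^{-j}\xi)$ for $\xi\ne 0$ and $\chi(0)=1$ (so that $S_0f=\sum_{j\le 0}\Delta_jf$ for $f\in L^2$), and $(1-\Delta)^{\alpha/2}f=\mathcal F^{-1}\big((1+|\xi|^2)^{\alpha/2}\mathcal F f\big)$. (If $V$ is a real Hilbert space, these are taken in the complexification of $V$.) For $\alpha\in\mathbb R$ and $1\le p<\infty$ put $$\|f\|_{H^\alpha_p(\mathbb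 R^d;V)}=\|(1-\Delta)^{\alpha/2}f\|_{L^p},\qquad \|f\|_{B^\alpha_{pp}(\mathbb R^d;V)}=\|S_0f\|_{L^p}+\Big(\sum_{j=1}^\infty 2^{j\alpha p}\|\Delta_jf\|_{L^p}^p\Big)^{1/p},$$ where the $L^p$-norm of a tempered distribution that is not an $L^p$-function is $\infty$; the spaces $H^\alpha_p(\mathbb R^d;V)$ and $B^\alpha_{pp}(\mathbb R^d;V)$ consist of the tempered distributions for which the respective norm is finite. **Theorem.** Let $V$ be a separable (real or complex) Hilbert space, $\alpha\in\mathbb R$ and $2\le p<\infty$. Then there exists a constant $C>0$ such that every $f\in H^\alpha_p(\mathbb R^d;V)$ belongs to $B^\alpha_{pp}(\mathbb R^d;V)$ and $$\|f\|_{B^\alpha_{pp}(\mathbb R^d;V)}\le C\,\|f\|_{H^\alpha_p(\mathbb R^d;V)}.$$ That is, $H^\alpha_p(\mathbb R^d;V)$ is continuously embedded into $B^\alpha_{pp}(\mathbb R^d;V)$. -/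

import Mathlib

open MeasureTheory
open scoped ENNReal ContDiff SchwartzMap InnerProductSpace

set_option linter.unusedSectionVars false

/-! ### The complexification of a real Hilbert space -/

/-- The complexification `V ⊕ iV` of a real Hilbert space `V`, with the Hilbert norm
`‖x + iy‖² = ‖x‖² + ‖y‖²`. The pair `(x, y)` stands for `x + iy`. -/
def Complexification (V : Type*) : Type _ := WithLp 2 (V × V)

namespace Complexification

noncomputable section

variable {V : Type*} [NormedAddCommGroup V] [InnerProductSpace ℝ V]

/-- The element `x + iy`. -/
def mk (x y : V) : Complexification V := WithLp.toLp 2 (x, y)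

/-- The real part of `x + iy`. -/
def re (z : Complexification V) : V := (WithLp.ofLp z).1

/-- The imaginary part of `x + iy`. -/
def im (z : Complexification V) : V := (WithLp.ofLp z).2

instance : NormedAddCommGroup (Complexification V) :=
  inferInstanceAs (NormedAddCommGroup (WithLp 2 (V × V)))

instance [CompleteSpace V] : CompleteSpace (Complexification V) :=
  inferInstanceAs (CompleteSpace (WithLp 2 (V × V)))

@[ext]
theorem ext {z w : Complexification V} (h₁ : z.re = w.re) (h₂ : z.im = w.im) : z = w :=
  WithLp.ofLp_injective 2 (Prod.ext h₁ h₂)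

@[simp] theorem mk_re (x y : V) : (mk x y).re = x := rfl
@[simp] theorem mk_im (x y : V) : (mk x y).im = y := rfl
@[simp] theorem add_re (z w : Complexification V) : (z + w).re = z.re + w.re := rfl
@[simp] theorem add_im (z w : Complexification V) : (z + w).im = z.im + w.im := rfl
@[simp] theorem zero_re : (0 : Complexification V).re = 0 := rfl
@[simp] theorem zero_im : (0 : Complexification V).im = 0 := rfl

theorem norm_sq_eq (z : Complexification V) : ‖z‖ ^ 2 = ‖z.re‖ ^ 2 + ‖z.im‖ ^ 2 :=
  WithLp.prod_norm_sq_eq_of_L2 (α := V) (β := V) z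

/-- `(a + ib)(x + iy) = (ax - by) + i(ay + bx)`. -/
instance : SMul ℂ (Complexification V) where
  smul c z := mk (c.re • z.re - c.im • z.im) (c.re • z.im + c.im • z.re)

@[simp] theorem smul_re (c : ℂ) (z : Complexification V) :
    (c • z).re = c.re • z.re - c.im • z.im := rfl
@[simp] theorem smul_im (c : ℂ) (z : Complexification V) :
    (c • z).im = c.re • z.im + c.im • z.re := rfl

instance : Module ℂ (Complexification V) where
  one_smul z := by ext <;> simp
  mul_smul a b z := by ext <;> simp <;> module
  smul_zero a := by ext <;> simp
  smul_add a z w := by ext <;> simp <;> module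
  add_smul a b z := by ext <;> simp <;> module
  zero_smul z := by ext <;> simp

/-- `⟪x₁ + ix₂, y₁ + iy₂⟫ = ⟪x₁, y₁⟫ + ⟪x₂, y₂⟫ + i (⟪x₁, y₂⟫ - ⟪x₂, y₁⟫)`. -/
instance : Inner ℂ (Complexification V) where
  inner z w := ⟨⟪z.re, w.re⟫_ℝ + ⟪z.im, w.im⟫_ℝ, ⟪z.re, w.im⟫_ℝ - ⟪z.im, w.re⟫_ℝ⟩

@[simp] theorem inner_re (z w : Complexification V) :
    (⟪z, w⟫_ℂ).re = ⟪z.re, w.re⟫_ℝ + ⟪z.im, w.im⟫_ℝ := rfl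
@[simp] theorem inner_im (z w : Complexification V) :
    (⟪z, w⟫_ℂ).im = ⟪z.re, w.im⟫_ℝ - ⟪z.im, w.re⟫_ℝ := rfl

instance : InnerProductSpace ℂ (Complexification V) where
  norm_smul_le c z := by
    refine le_of_eq ?_
    rw [← sq_eq_sq₀ (norm_nonneg _) (by positivity), mul_pow, norm_sq_eq, norm_sq_eq, smul_re,
      smul_im, norm_sub_sq_real, norm_add_sq_real, Complex.sq_norm, Complex.normSq_apply]
    simp only [norm_smul, Real.norm_eq_abs, mul_pow, sq_abs, inner_smul_left, inner_smul_right,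
      real_inner_comm z.re z.im, conj_trivial]
    ring
  norm_sq_eq_re_inner z := by
    rw [norm_sq_eq]
    change _ = (⟪z, z⟫_ℂ).re
    simp
  conj_inner_symm z w := by
    apply Complex.ext
    · simp [real_inner_comm]
    · simp [real_inner_comm]
  add_left z w u := by
    apply Complex.ext
    · simp [inner_add_left]; ring
    · simp [inner_add_left]; ring
  smul_left z w c := by
    apply Complex.ext
    · simp [inner_add_left, inner_sub_left, inner_smul_left]; ring
    · simp [inner_add_left, inner_sub_left, inner_smul_left]; ring

end

end Complexification

/-! ### Function spaces of tempered distributions -/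

namespace VectorBesov

noncomputable section

variable {E F : Type*} [NormedAddCommGroup E] [InnerProductSpace ℝ E] [FiniteDimensional ℝ E]
  [MeasurableSpace E] [BorelSpace E] [NormedAddCommGroup F] [NormedSpace ℂ F]

/-- The operator `f ↦ ℱ⁻¹ (m · ℱ f)` for the Fourier transform `ℱ` with kernel
`(2π)^{-d/2} exp (-i x·ξ)`. The Fourier transform of Mathlib has the kernel `exp (-2πi x·ξ)`, so
that its frequency variable is multiplied by `2π` here. -/
def multiplier (m : E → ℂ) : 𝓢'(E, F) →L[ℂ] 𝓢'(E, F) :=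
  TemperedDistribution.fourierMultiplierCLM F (fun ξ ↦ m ((2 * Real.pi) • ξ))

/-- A function `Φ` that generates a Littlewood-Paley decomposition: it is smooth and nonnegative,
its support is `{ξ | 1/2 ≤ |ξ| ≤ 2}`, and `∑_{j ∈ ℤ} Φ (2^{-j} ξ) = 1` for `ξ ≠ 0`. -/
structure IsLittlewoodPaley (Φ : E → ℝ) : Prop where
  contDiff : ContDiff ℝ ∞ Φ
  nonneg : ∀ ξ, 0 ≤ Φ ξ
  tsupport_eq : tsupport Φ = {ξ | 1 / 2 ≤ ‖ξ‖ ∧ ‖ξ‖ ≤ 2}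
  hasSum : ∀ ξ, ξ ≠ 0 → HasSum (fun j : ℤ ↦ Φ ((2 : ℝ) ^ (-j) • ξ)) 1

/-- The Littlewood-Paley block `Δ_j f = ℱ⁻¹ (Φ (2^{-j} ξ) ℱ f (ξ))`. -/
def block (Φ : E → ℝ) (j : ℤ) : 𝓢'(E, F) →L[ℂ] 𝓢'(E, F) :=
  multiplier (fun ξ ↦ (Φ ((2 : ℝ) ^ (-j) • ξ) : ℂ))

open scoped Classical in
/-- The symbol `∑_{j ≤ 0} Φ (2^{-j} ξ)` of `S_0 = ∑_{j ≤ 0} Δ_j`, with its continuous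
extension `1` at `ξ = 0`. -/
def lowSymbol (Φ : E → ℝ) (ξ : E) : ℝ :=
  if ξ = 0 then 1 else ∑' j : ℕ, Φ ((2 : ℝ) ^ j • ξ)

/-- The low frequency part `S_0 f = ∑_{j ≤ 0} Δ_j f` of a tempered distribution. -/
def lowPart (Φ : E → ℝ) : 𝓢'(E, F) →L[ℂ] 𝓢'(E, F) :=
  multiplier (fun ξ ↦ (lowSymbol Φ ξ : ℂ))

/-- The Bessel potential operator `(1 - Δ)^{α/2}`, with symbol `(1 + |ξ|²)^{α/2}`. -/
def bessel (α : ℝ) : 𝓢'(E, F) →L[ℂ] 𝓢'(E, F) :=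
  multiplier (fun ξ ↦ (((1 + ‖ξ‖ ^ 2) ^ (α / 2) : ℝ) : ℂ))

/-- The norm of `u` in `L^p(E; F)`: it is `‖g‖_{L^p}` if the tempered distribution `u` is given by
integration against a function `g` in `L^p(E; F)` (which is then unique up to null sets), and `∞`
if there is no such function. -/
def lpENorm (p : ℝ) (u : 𝓢'(E, F)) : ℝ≥0∞ :=
  ⨅ (g : E → F) (_ : MemLp g (ENNReal.ofReal p) volume)
    (_ : ∀ φ : 𝓢(E, ℂ), u φ = ∫ x, φ x • g x), eLpNorm g (ENNReal.ofReal p) volume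

/-- The norm `‖(1 - Δ)^{α/2} f‖_{L^p}` of `H^α_p(E; F)`; it is `∞` off this space. -/
def sobolevENorm (α p : ℝ) (f : 𝓢'(E, F)) : ℝ≥0∞ :=
  lpENorm p (bessel α f)

/-- The norm `‖S_0 f‖_{L^p} + (∑_{j ≥ 1} 2^{jαp} ‖Δ_j f‖_{L^p}^p)^{1/p}` of `B^α_{pp}(E; F)`;
it is `∞` off this space. -/
def besovENorm (Φ : E → ℝ) (α p : ℝ) (f : 𝓢'(E, F)) : ℝ≥0∞ :=
  lpENorm p (lowPart Φ f) +
    (∑' j : ℕ, ENNReal.ofReal ((2 : ℝ) ^ (((j : ℝ) + 1) * α * p)) *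
      lpENorm p (block Φ ((j : ℤ) + 1) f) ^ p) ^ (1 / p)

/-- `f` belongs to `H^α_p(E; F)`. -/
def MemSobolev (α p : ℝ) (f : 𝓢'(E, F)) : Prop := sobolevENorm α p f < ⊤

/-- `f` belongs to `B^α_{pp}(E; F)`. -/
def MemBesov (Φ : E → ℝ) (α p : ℝ) (f : 𝓢'(E, F)) : Prop := besovENorm Φ α p f < ⊤

/-- The extension of a tempered distribution `f` with values in a real Hilbert space `V`, that is,
of a continuous real-linear map from the real Schwartz functions to `V`, to the complex Schwartz
functions, with values in the complexification of `V`: `φ ↦ f (Re φ) + i f (Im φ)`. -/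
def complexify {V : Type*} [NormedAddCommGroup V] [InnerProductSpace ℝ V]
    (f : 𝓢(E, ℝ) →Lₚₜ[ℝ] V) : 𝓢'(E, Complexification V) where
  toFun φ := Complexification.mk (f (φ.postcompCLM Complex.reCLM)) (f (φ.postcompCLM Complex.imCLM))
  map_add' φ ψ := by ext <;> simp
  map_smul' c φ := by
    have h₁ : (c • φ).postcompCLM Complex.reCLM =
        c.re • φ.postcompCLM Complex.reCLM - c.im • φ.postcompCLM Complex.imCLM := by
      ext x; simp
    have h₂ : (c • φ).postcompCLM Complex.imCLM =
        c.re • φ.postcompCLM Complex.imCLM + c.im • φ.postcompCLM Complex.reCLM := by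
      ext x; simp
    ext <;> simp [h₁, h₂]
  cont := by
    have h : Continuous (fun φ : 𝓢(E, ℂ) ↦
        ((f (φ.postcompCLM Complex.reCLM), f (φ.postcompCLM Complex.imCLM)) : V × V)) := by
      fun_prop
    exact (WithLp.prod_continuous_toLp 2 V V).comp h

/-! ### The symbols are admissible, and `S_0 = ∑_{j ≤ 0} Δ_j` on `L²` -/

theorem hasTemperateGrowth_bessel (α : ℝ) : Function.HasTemperateGrowth
    (fun ξ : E ↦ (((1 + ‖(2 * Real.pi) • ξ‖ ^ 2) ^ (α / 2) : ℝ) : ℂ)) := by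
  have h : Function.HasTemperateGrowth (fun ξ : E ↦ (2 * Real.pi) • ξ) := by fun_prop
  have h' : Function.HasTemperateGrowth
      (fun ξ : E ↦ (((1 + ‖ξ‖ ^ 2) ^ (α / 2) : ℝ) : ℂ)) := by fun_prop
  exact h'.comp h

namespace IsLittlewoodPaley

variable {Φ : E → ℝ}

theorem eq_zero (hΦ : IsLittlewoodPaley Φ) {ξ : E} (h : ¬ (1 / 2 ≤ ‖ξ‖ ∧ ‖ξ‖ ≤ 2)) : Φ ξ = 0 := by
  apply image_eq_zero_of_notMem_tsupport
  rwa [hΦ.tsupport_eq]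

theorem hasCompactSupport (hΦ : IsLittlewoodPaley Φ) : HasCompactSupport Φ := by
  refine HasCompactSupport.of_support_subset_isCompact (isCompact_closedBall (0 : E) 2) ?_
  intro ξ hξ
  by_contra h
  exact hξ (hΦ.eq_zero fun h' ↦ h (by simpa using h'.2))

theorem hasTemperateGrowth_block (hΦ : IsLittlewoodPaley Φ) (j : ℤ) : Function.HasTemperateGrowth
    (fun ξ : E ↦ (Φ ((2 : ℝ) ^ (-j) • (2 * Real.pi) • ξ) : ℂ)) := by
  have h : Function.HasTemperateGrowth (fun ξ : E ↦ (2 : ℝ) ^ (-j) • (2 * Real.pi) • ξ) := by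
    fun_prop
  exact (Function.HasTemperateGrowth.comp Complex.ofRealCLM.hasTemperateGrowth
    (hΦ.hasCompactSupport.hasTemperateGrowth hΦ.contDiff)).comp h

theorem hasSum_lowSymbol (hΦ : IsLittlewoodPaley Φ) {ξ : E} (hξ : ξ ≠ 0) :
    HasSum (fun j : ℕ ↦ Φ ((2 : ℝ) ^ j • ξ)) (lowSymbol Φ ξ) := by
  have h : Summable (fun j : ℕ ↦ Φ ((2 : ℝ) ^ j • ξ)) := by
    have := (hΦ.hasSum ξ hξ).summable.comp_injective
      (i := fun j : ℕ ↦ -(j : ℤ)) (fun a b hab ↦ by simpa using hab)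
    simpa [Function.comp_def] using this
  simpa [lowSymbol, hξ] using h.hasSum

theorem lowSymbol_eq (hΦ : IsLittlewoodPaley Φ) (ξ : E) :
    lowSymbol Φ ξ = 1 - ∑' j : ℕ, Φ ((2 : ℝ) ^ (-((j : ℤ) + 1)) • ξ) := by
  by_cases hξ : ξ = 0
  · have h0 : Φ 0 = 0 := hΦ.eq_zero (by norm_num)
    simp [lowSymbol, hξ, h0]
  · have h1 := (hΦ.hasSum ξ hξ)
    have h2 : HasSum (fun j : ℤ ↦ Φ ((2 : ℝ) ^ j • ξ)) 1 := by
      have := (Equiv.neg ℤ).hasSum_iff.mpr h1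
      simpa [Function.comp_def] using this
    have h3 : Summable (fun j : ℕ ↦ Φ ((2 : ℝ) ^ (-((j : ℤ) + 1)) • ξ)) := by
      exact h2.summable.comp_injective (i := fun j : ℕ ↦ -((j : ℤ) + 1))
        (fun a b hab ↦ by simpa using hab)
    have h4 := HasSum.of_nat_of_neg_add_one (f := fun j : ℤ ↦ Φ ((2 : ℝ) ^ j • ξ))
      (by simpa using hΦ.hasSum_lowSymbol hξ) h3.hasSum
    linarith [h2.unique h4]

theorem contDiff_lowSymbol (hΦ : IsLittlewoodPaley Φ) : ContDiff ℝ ∞ (lowSymbol Φ) := by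
  rw [contDiff_iff_contDiffAt]
  intro ξ₀
  obtain ⟨n, hn⟩ := pow_unbounded_of_one_lt ‖ξ₀‖ (one_lt_two (α := ℝ))
  have h : lowSymbol Φ =ᶠ[nhds ξ₀] fun ξ ↦
      1 - ∑ j ∈ Finset.range n, Φ ((2 : ℝ) ^ (-((j : ℤ) + 1)) • ξ) := by
    have hU : {ξ : E | ‖ξ‖ < 2 ^ n} ∈ nhds ξ₀ :=
      (isOpen_lt continuous_norm continuous_const).mem_nhds hn
    filter_upwards [hU] with ξ hξ
    rw [hΦ.lowSymbol_eq, tsum_eq_sum]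
    intro j hj
    apply hΦ.eq_zero
    rintro ⟨h, -⟩
    have hj' : (2 : ℝ) ^ n ≤ 2 ^ j := pow_le_pow_right₀ one_le_two (by simpa using hj)
    have hξ' : ‖ξ‖ < 2 ^ j := lt_of_lt_of_le hξ hj'
    rw [norm_smul, zpow_neg, zpow_add_one₀ two_ne_zero, zpow_natCast, norm_inv, norm_mul,
      norm_pow, Real.norm_ofNat, mul_inv] at h
    have h5 : ((2 : ℝ) ^ j)⁻¹ * ‖ξ‖ < 1 := by
      rw [inv_mul_lt_iff₀ (by positivity)]; simpa using hξ'
    nlinarith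
  refine ContDiffAt.congr_of_eventuallyEq ?_ h
  refine contDiffAt_const.sub (ContDiffAt.sum fun j _ ↦ ?_)
  exact (hΦ.contDiff.comp (contDiff_const_smul _)).contDiffAt

theorem hasCompactSupport_lowSymbol (hΦ : IsLittlewoodPaley Φ) :
    HasCompactSupport (lowSymbol Φ) := by
  refine HasCompactSupport.of_support_subset_isCompact (isCompact_closedBall (0 : E) 2) ?_
  intro ξ hξ
  by_contra h
  have h2 : 2 < ‖ξ‖ := by simpa using h
  have h0 : ξ ≠ 0 := by rintro rfl; simp at h2; linarith
  apply hξ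
  refine (hΦ.hasSum_lowSymbol h0).unique ?_
  convert hasSum_zero using 2 with j
  apply hΦ.eq_zero
  rintro ⟨-, h3⟩
  rw [norm_smul, norm_pow, Real.norm_ofNat] at h3
  nlinarith [one_le_pow₀ (one_le_two (α := ℝ)) (n := j)]

theorem hasTemperateGrowth_lowSymbol (hΦ : IsLittlewoodPaley Φ) : Function.HasTemperateGrowth
    (fun ξ : E ↦ (lowSymbol Φ ((2 * Real.pi) • ξ) : ℂ)) := by
  have h : Function.HasTemperateGrowth (fun ξ : E ↦ (2 * Real.pi) • ξ) := by fun_prop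
  exact (Function.HasTemperateGrowth.comp Complex.ofRealCLM.hasTemperateGrowth
    (hΦ.hasCompactSupport_lowSymbol.hasTemperateGrowth hΦ.contDiff_lowSymbol)).comp h

theorem multiplier_apply_L2 {H : Type*} [NormedAddCommGroup H] [InnerProductSpace ℂ H]
    [CompleteSpace H] {m : E → ℂ}
    (hm : Function.HasTemperateGrowth (fun ξ : E ↦ m ((2 * Real.pi) • ξ)))
    (f : Lp H 2 (volume : Measure E)) (φ : 𝓢(E, ℂ)) :
    multiplier m (f : 𝓢'(E, H)) φ = ∫ ξ, m ((2 * Real.pi) • ξ) •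
      (FourierTransformInv.fourierInv φ : 𝓢(E, ℂ)) ξ •
        (FourierTransform.fourier f : Lp H 2 (volume : Measure E)) ξ := by
  rw [multiplier, TemperedDistribution.fourierMultiplierCLM_apply,
    TemperedDistribution.fourierInv_apply, Lp.fourier_toTemperedDistribution_eq,
    TemperedDistribution.smulLeftCLM_apply_apply, Lp.toTemperedDistribution_apply]
  refine integral_congr_ae (Filter.Eventually.of_forall fun ξ ↦ ?_)
  beta_reduce
  rw [SchwartzMap.smulLeftCLM_apply_apply hm, smul_assoc]

/-- On `L²`, the operator `S_0` is the sum of the operators `Δ_j` with `j ≤ 0`. -/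
theorem hasSum_block [Nontrivial E] {H : Type*} [NormedAddCommGroup H] [InnerProductSpace ℂ H]
    [CompleteSpace H] (hΦ : IsLittlewoodPaley Φ) (f : Lp H 2 (volume : Measure E)) :
    HasSum (fun j : ℕ ↦ block Φ (-(j : ℤ)) (f : 𝓢'(E, H))) (lowPart Φ (f : 𝓢'(E, H))) := by
  refine PointwiseConvergenceCLM.tendsto_iff_forall_tendsto.mpr fun φ ↦ ?_
  suffices h : HasSum (fun j : ℕ ↦ block Φ (-(j : ℤ)) (f : 𝓢'(E, H)) φ)
      (lowPart Φ (f : 𝓢'(E, H)) φ) by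
    simpa [HasSum] using h
  set ψ : 𝓢(E, ℂ) := FourierTransformInv.fourierInv φ
  set g : Lp H 2 (volume : Measure E) := FourierTransform.fourier f
  have hint : Integrable (fun ξ ↦ ψ ξ • g ξ) := by
    have := (Lp.memLp g).smul (r := 1) (ψ.memLp 2 volume)
    exact memLp_one_iff_integrable.mp this
  have hmul : ∀ χ : E → ℝ, Continuous χ → HasCompactSupport χ →
      Integrable (fun ξ ↦ (χ ((2 * Real.pi) • ξ) : ℂ) • ψ ξ • g ξ) := by
    intro χ hχ hχ'
    obtain ⟨C, hC⟩ := hχ.bounded_above_of_compact_support hχ'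
    refine hint.bdd_smul C (by fun_prop) (Filter.Eventually.of_forall fun ξ ↦ ?_)
    simpa using hC ((2 * Real.pi) • ξ)
  have hblock (j : ℕ) : block Φ (-(j : ℤ)) (f : 𝓢'(E, H)) φ =
      ∫ ξ, (Φ ((2 : ℝ) ^ j • (2 * Real.pi) • ξ) : ℂ) • ψ ξ • g ξ := by
    rw [block, multiplier_apply_L2 (hΦ.hasTemperateGrowth_block _)]
    simp [ψ, g]
  rw [lowPart, multiplier_apply_L2 hΦ.hasTemperateGrowth_lowSymbol]
  simp_rw [hblock]
  have hae : ∀ᵐ ξ : E, HasSum (fun j : ℕ ↦ Φ ((2 : ℝ) ^ j • (2 * Real.pi) • ξ))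
      (lowSymbol Φ ((2 * Real.pi) • ξ)) := by
    have : ∀ᵐ ξ : E, ξ ≠ 0 := by simp [ae_iff]
    filter_upwards [this] with ξ hξ
    exact hΦ.hasSum_lowSymbol (smul_ne_zero (by positivity) hξ)
  have hnorm (j : ℕ) (ξ : E) : ‖(Φ ((2 : ℝ) ^ j • (2 * Real.pi) • ξ) : ℂ) • ψ ξ • g ξ‖ =
      Φ ((2 : ℝ) ^ j • (2 * Real.pi) • ξ) * ‖ψ ξ • g ξ‖ := by
    rw [norm_smul, Complex.norm_real, Real.norm_of_nonneg (hΦ.nonneg _)]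
  refine hasSum_integral_of_dominated_convergence
    (fun j ξ ↦ Φ ((2 : ℝ) ^ j • (2 * Real.pi) • ξ) * ‖ψ ξ • g ξ‖) (fun j ↦ ?_) (fun j ↦ ?_) ?_ ?_ ?_
  · have h1 := hΦ.contDiff.continuous
    exact AEStronglyMeasurable.smul
      (Continuous.aestronglyMeasurable (by fun_prop)) hint.aestronglyMeasurable
  · exact Filter.Eventually.of_forall fun ξ ↦ (hnorm j ξ).le
  · filter_upwards [hae] with ξ hξ using hξ.summable.mul_right _
  · refine (hmul _ hΦ.contDiff_lowSymbol.continuous hΦ.hasCompactSupport_lowSymbol).norm.congr ?_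
    filter_upwards [hae] with ξ hξ
    have h0 : 0 ≤ lowSymbol Φ ((2 * Real.pi) • ξ) := hξ.nonneg fun j ↦ hΦ.nonneg _
    rw [(hξ.mul_right _).tsum_eq, norm_smul, Complex.norm_real, Real.norm_of_nonneg h0]
  · filter_upwards [hae] with ξ hξ
    exact (Complex.hasSum_ofReal.mpr hξ).smul_const _

end IsLittlewoodPaley

end

end VectorBesov

/-! Put `g = (1 - Δ)^{α/2} f ∈ L^p`. The Besov norm of `f` is assembled from the functions `T_i g`,
where `T_0 = S_0 (1 - Δ)^{-α/2}` and `T_j = 2^{jα} Δ_j (1 - Δ)^{-α/2}` for `j ≥ 1`. It therefore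
suffices that `g ↦ (T_i g)_i` is bounded from `L^p` to `ℓ^p(L^p)`. This follows by Marcinkiewicz
interpolation (`tsum_lintegral_enorm_rpow_le`) between two endpoints; no square function or
vector-valued singular integral theory is needed.

`L^∞ → ℓ^∞(L^∞)`: the convolution kernels are bounded in `L¹` uniformly in `i`. Up to a dilation,
which preserves the `L¹` norm of the kernel, the symbol of `T_j` is `Φ(η) (ε² + |η|²)^{-α/2}` with
`ε = 2^{-j}`. This is jointly smooth in `(η, ε)`, including at `ε = 0`, and supported in `|η| ≤ 2`,
so its Schwartz seminorms are bounded for `ε ∈ [0, 1]` (`exists_integral_norm_besovSymbol_le`).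

`L² → ℓ²(L²)`: by Plancherel, valid because `V` is a Hilbert space, it is enough that the squares of
the symbols have a bounded sum. They are dominated by multiples of `Φ(2^{-j} ξ)`, which sum to at
most `1` (`exists_tsum_enorm_besovSymbol_sq_le`). -/

namespace VectorBesov

/-! ### Marcinkiewicz interpolation for countable families of operators -/

open FourierTransform

/-- The summation step of the Marcinkiewicz interpolation theorem between `L²` and `L^∞`. -/
theorem tsum_lintegral_rpow_le_of_meas_lt_le {ι X : Type*} [Countable ι] [MeasurableSpace X]
    {μ : Measure X} [SFinite μ] {f : ι → X → ℝ} {h : X → ℝ} {B : ℝ≥0∞} {p : ℝ} (hp : 2 < p)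
    (hf : ∀ i, AEMeasurable (f i) μ) (hf0 : ∀ i x, 0 ≤ f i x)
    (hh : AEMeasurable h μ) (hh0 : ∀ x, 0 ≤ h x)
    (hfh : ∀ t : ℝ, 0 < t → ∑' i, μ {x | t < f i x} ≤
      B * ENNReal.ofReal (t ^ (-2 : ℝ)) * ∫⁻ x in {x | t < h x}, ENNReal.ofReal (h x ^ 2) ∂μ) :
    ∑' i, ∫⁻ x, ENNReal.ofReal (f i x ^ p) ∂μ ≤
      B * ENNReal.ofReal (p / (p - 2)) * ∫⁻ x, ENNReal.ofReal (h x ^ p) ∂μ := by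
  have hp0 : 0 < p := by linarith
  have hp2 : 0 < p - 2 := by linarith
  -- With the weight `h²` absorbed into the measure, the right-hand side is a layer-cake integral of
  -- exponent `p - 2`. Comparing the factors `p` and `p - 2` yields the constant `p / (p - 2)`.
  set ν := μ.withDensity (fun x ↦ ENNReal.ofReal (h x ^ 2)) with hν
  have hdens : AEMeasurable (fun x ↦ ENNReal.ofReal (h x ^ 2)) μ := by fun_prop
  have hhν : AEMeasurable h ν := hh.mono_ac (withDensity_absolutelyContinuous _ _)
  have hI : ∫⁻ x, ENNReal.ofReal (h x ^ p) ∂μ = ∫⁻ x, ENNReal.ofReal (h x ^ (p - 2)) ∂ν := by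
    rw [hν, lintegral_withDensity_eq_lintegral_mul₀ hdens (by fun_prop)]
    refine lintegral_congr fun x ↦ ?_
    rw [Pi.mul_apply, ← ENNReal.ofReal_mul (by positivity)]
    rcases (hh0 x).eq_or_lt with h0 | h0
    · simp [← h0, Real.zero_rpow hp0.ne']
    · rw [← Real.rpow_natCast, ← Real.rpow_add h0]
      norm_num
  rw [hI, lintegral_rpow_eq_lintegral_meas_lt_mul ν (ae_of_all _ hh0) hhν hp2]
  have hmeas (i : ι) : Measurable fun t : ℝ ↦ μ {x | t < f i x} :=
    Antitone.measurable fun s t hst ↦ measure_mono fun x hx ↦ lt_of_le_of_lt hst hx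
  calc ∑' i, ∫⁻ x, ENNReal.ofReal (f i x ^ p) ∂μ
      = ENNReal.ofReal p * ∫⁻ t in Set.Ioi (0 : ℝ),
          (∑' i, μ {x | t < f i x}) * ENNReal.ofReal (t ^ (p - 1)) := by
        have h1 (i : ι) := lintegral_rpow_eq_lintegral_meas_lt_mul μ (ae_of_all _ (hf0 i)) (hf i) hp0
        have h2 : ∫⁻ t in Set.Ioi (0 : ℝ), (∑' i, μ {x | t < f i x}) * ENNReal.ofReal (t ^ (p - 1)) =
            ∑' i, ∫⁻ t in Set.Ioi (0 : ℝ), μ {x | t < f i x} * ENNReal.ofReal (t ^ (p - 1)) := by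
          simp_rw [← ENNReal.tsum_mul_right]
          exact lintegral_tsum fun i ↦ Measurable.aemeasurable ((hmeas i).mul (by fun_prop))
        rw [h2, ← ENNReal.tsum_mul_left]
        exact tsum_congr h1
    _ ≤ ENNReal.ofReal p * ∫⁻ t in Set.Ioi (0 : ℝ),
          B * (ν {x | t < h x} * ENNReal.ofReal (t ^ (p - 2 - 1))) := by
        gcongr ENNReal.ofReal p * ?_
        refine setLIntegral_mono' measurableSet_Ioi fun t ht ↦ ?_
        have ht' : 0 < t := ht
        refine (mul_le_mul_left (hfh t ht) _).trans_eq ?_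
        rw [hν, withDensity_apply' _ _]
        have : ENNReal.ofReal (t ^ (p - 2 - 1)) =
            ENNReal.ofReal (t ^ (-2 : ℝ)) * ENNReal.ofReal (t ^ (p - 1)) := by
          rw [← ENNReal.ofReal_mul (by positivity), ← Real.rpow_add ht']
          ring_nf
        rw [this]
        ring
    _ = _ := by
        have hm : Measurable fun t : ℝ ↦ ν {x | t < h x} :=
          Antitone.measurable fun s t hst ↦ measure_mono fun x hx ↦ lt_of_le_of_lt hst hx
        have hm' : Measurable fun t : ℝ ↦ ν {x | t < h x} * ENNReal.ofReal (t ^ (p - 2 - 1)) :=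
          hm.mul (by fun_prop)
        rw [lintegral_const_mul _ hm']
        have : ENNReal.ofReal p = ENNReal.ofReal (p / (p - 2)) * ENNReal.ofReal (p - 2) := by
          rw [← ENNReal.ofReal_mul (by positivity), div_mul_cancel₀ _ hp2.ne']
        rw [this]
        ring

/-- The Marcinkiewicz interpolation theorem for a countable family of operators that is bounded
from `L^∞` to `ℓ^∞(L^∞)` and from `L²` to `ℓ²(L²)`. -/
theorem tsum_lintegral_enorm_rpow_le {ι X F G : Type*} [Countable ι] [MeasurableSpace X]
    [NormedAddCommGroup F] [NormedAddCommGroup G] {μ : Measure X} [SFinite μ]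
    {T : ι → (X → F) → X → G} {g : X → F} {A : ℝ} {B : ℝ≥0∞} {p : ℝ} (hA : 0 < A) (hp : 2 < p)
    (hg : AEStronglyMeasurable g μ) (hT : ∀ i, AEStronglyMeasurable (T i g) μ)
    (hadd : ∀ t : ℝ, 0 < t → ∀ i x,
      T i g x = T i ({x | ‖g x‖ ≤ t}.indicator g) x + T i ({x | t < ‖g x‖}.indicator g) x)
    (hlow : ∀ t : ℝ, 0 < t → ∀ i x, ‖T i ({x | ‖g x‖ ≤ t}.indicator g) x‖ ≤ A * t)
    (hhighm : ∀ t : ℝ, 0 < t → ∀ i, AEStronglyMeasurable (T i ({x | t < ‖g x‖}.indicator g)) μ)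
    (hhigh : ∀ t : ℝ, 0 < t → ∑' i, ∫⁻ x, ‖T i ({x | t < ‖g x‖}.indicator g) x‖ₑ ^ 2 ∂μ ≤
      B * ∫⁻ x in {x | t < ‖g x‖}, ‖g x‖ₑ ^ 2 ∂μ) :
    ∑' i, ∫⁻ x, ‖T i g x‖ₑ ^ p ∂μ ≤
      ENNReal.ofReal ((2 * A) ^ p) * (B * ENNReal.ofReal ((A ^ 2)⁻¹) *
        ENNReal.ofReal (p / (p - 2))) * ∫⁻ x, ‖g x‖ₑ ^ p ∂μ := by
  have hp0 : 0 < p := by linarith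
  -- Level `t` of the normalised function is level `2At` of `‖T i g‖`. The part of `g` below height
  -- `t` accounts for at most `At` of it, so the part above must contribute at least `At`, and
  -- Chebyshev's inequality in `L²` applies to that part.
  have key := tsum_lintegral_rpow_le_of_meas_lt_le (μ := μ)
    (f := fun i x ↦ (2 * A)⁻¹ * ‖T i g x‖) (h := fun x ↦ ‖g x‖)
    (B := B * ENNReal.ofReal ((A ^ 2)⁻¹)) hp (fun i ↦ (hT i).norm.aemeasurable.const_mul _)
    (fun i x ↦ by positivity) hg.norm.aemeasurable (fun x ↦ norm_nonneg _) ?_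
  · have h1 (y : G) : ‖y‖ₑ ^ p =
        ENNReal.ofReal ((2 * A) ^ p) * ENNReal.ofReal (((2 * A)⁻¹ * ‖y‖) ^ p) := by
      rw [← ENNReal.ofReal_mul (by positivity), ← Real.mul_rpow (by positivity) (by positivity),
        mul_inv_cancel_left₀ (by positivity), ← ofReal_norm,
        ENNReal.ofReal_rpow_of_nonneg (norm_nonneg _) hp0.le]
    have h2 (y : F) : ‖y‖ₑ ^ p = ENNReal.ofReal (‖y‖ ^ p) := by
      rw [← ofReal_norm, ENNReal.ofReal_rpow_of_nonneg (norm_nonneg _) hp0.le]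
    simp_rw [h1, h2]
    simp_rw [lintegral_const_mul' _ _ ENNReal.ofReal_ne_top]
    rw [ENNReal.tsum_mul_left, mul_assoc]
    gcongr
  · intro t ht
    have hsq (x : X) : ENNReal.ofReal (‖g x‖ ^ 2) = ‖g x‖ₑ ^ 2 := by
      rw [ENNReal.ofReal_pow (norm_nonneg _), ofReal_norm]
    simp_rw [hsq]
    have hAt : ENNReal.ofReal ((A ^ 2)⁻¹) * ENNReal.ofReal (t ^ (-2 : ℝ)) =
        (ENNReal.ofReal (A * t) ^ 2)⁻¹ := by
      rw [← ENNReal.ofReal_mul (by positivity), ← ENNReal.ofReal_pow (by positivity),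
        ← ENNReal.ofReal_inv_of_pos (by positivity), Real.rpow_neg ht.le, Real.rpow_ofNat,
        mul_pow, mul_inv]
    have hi (i : ι) : μ {x | t < (2 * A)⁻¹ * ‖T i g x‖} ≤ (ENNReal.ofReal (A * t) ^ 2)⁻¹ *
        ∫⁻ x, ‖T i ({x | t < ‖g x‖}.indicator g) x‖ₑ ^ 2 ∂μ := by
      have hne : ENNReal.ofReal (A * t) ^ 2 ≠ 0 := by simp; positivity
      rw [mul_comm _ (lintegral _ _), ← div_eq_mul_inv]
      refine le_trans ?_ (meas_ge_le_lintegral_div ((hhighm t ht i).enorm.pow_const 2)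
        hne (by finiteness))
      gcongr with x
      intro hx
      rw [lt_inv_mul_iff₀ (by positivity)] at hx
      rw [← ofReal_norm]
      gcongr
      have h1 := norm_add_le (T i ({x | ‖g x‖ ≤ t}.indicator g) x)
        (T i ({x | t < ‖g x‖}.indicator g) x)
      rw [← hadd t ht] at h1
      have h2 := hlow t ht i x
      linarith
    calc ∑' i, μ {x | t < (2 * A)⁻¹ * ‖T i g x‖}
        ≤ ∑' i, (ENNReal.ofReal (A * t) ^ 2)⁻¹ *
          ∫⁻ x, ‖T i ({x | t < ‖g x‖}.indicator g) x‖ₑ ^ 2 ∂μ := ENNReal.tsum_le_tsum hi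
      _ ≤ (ENNReal.ofReal (A * t) ^ 2)⁻¹ * (B * ∫⁻ x in {x | t < ‖g x‖}, ‖g x‖ₑ ^ 2 ∂μ) := by
        rw [ENNReal.tsum_mul_left]
        gcongr
        exact hhigh t ht
      _ = _ := by
        rw [← hAt]
        ring

/-! ### Convolution with Schwartz kernels -/

section Kernel

variable {E V : Type*} [NormedAddCommGroup E] [InnerProductSpace ℝ E] [FiniteDimensional ℝ E]
  [MeasurableSpace E] [BorelSpace E] [NormedAddCommGroup V] [NormedSpace ℂ V]

/-- The convolution `K * g` of a scalar kernel with a vector-valued function. -/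
noncomputable def kernelConv (K : E → ℂ) (g : E → V) (y : E) : V := ∫ x, K (y - x) • g x

/-- The majorant `1 + h` with `h` integrable stands in for `g ∈ L^p`: it covers all finite `p ≥ 1`
(take `h = ‖g‖ ^ p`) and passes to truncations of `g`. The constant `1` is paired with `K ∈ L¹`, and
`h ∈ L¹` with `K ∈ L^∞`. -/
theorem norm_kernel_smul_le {K : E → ℂ} {M : ℝ} (hM : ∀ x, ‖K x‖ ≤ M) {g : E → V} {h : E → ℝ}
    (h0 : ∀ x, 0 ≤ h x) (hgh : ∀ x, ‖g x‖ ≤ 1 + h x) (y x : E) :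
    ‖K (y - x) • g x‖ ≤ ‖K (y - x)‖ + M * h x := by
  rw [norm_smul]
  calc ‖K (y - x)‖ * ‖g x‖ ≤ ‖K (y - x)‖ * (1 + h x) := by gcongr; exact hgh x
    _ = ‖K (y - x)‖ + ‖K (y - x)‖ * h x := by ring
    _ ≤ _ := by gcongr; exacts [h0 x, hM _]

theorem exists_norm_le_schwartz (K : 𝓢(E, ℂ)) : ∃ M : ℝ, ∀ x, ‖K x‖ ≤ M :=
  ⟨_, K.norm_le_seminorm ℝ⟩

variable {g : E → V} {h : E → ℝ}

theorem integrable_kernel_smul (K : 𝓢(E, ℂ)) (hg : AEStronglyMeasurable g) (hh : Integrable h)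
    (h0 : ∀ x, 0 ≤ h x) (hgh : ∀ x, ‖g x‖ ≤ 1 + h x) (y : E) :
    Integrable fun x ↦ K (y - x) • g x := by
  obtain ⟨M, hM⟩ := exists_norm_le_schwartz K
  refine ((K.integrable.comp_sub_left y).norm.add (hh.const_mul M)).mono' ?_
    (ae_of_all _ (norm_kernel_smul_le hM h0 hgh y))
  exact AEStronglyMeasurable.smul (Continuous.aestronglyMeasurable (by fun_prop)) hg

theorem aestronglyMeasurable_kernelConv (K : 𝓢(E, ℂ)) (hg : AEStronglyMeasurable g) :
    AEStronglyMeasurable (kernelConv K g) := by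
  have : AEStronglyMeasurable (fun z : E × E ↦ K (z.1 - z.2) • g z.2)
      ((volume : Measure E).prod volume) :=
    AEStronglyMeasurable.smul (Continuous.aestronglyMeasurable (by fun_prop)) hg.comp_snd
  exact this.integral_prod_right'

theorem norm_kernelConv_le (K : 𝓢(E, ℂ)) {t : ℝ} (hgt : ∀ x, ‖g x‖ ≤ t) (y : E) :
    ‖kernelConv K g y‖ ≤ (∫ x, ‖K x‖) * t := by
  calc ‖kernelConv K g y‖ ≤ ∫ x, ‖K (y - x)‖ * t := by
        refine norm_integral_le_of_norm_le
          ((K.integrable.comp_sub_left y).norm.mul_const t) (ae_of_all _ fun x ↦ ?_)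
        rw [norm_smul]
        gcongr
        exact hgt x
    _ = _ := by
        rw [integral_mul_const, integral_sub_left_eq_self (fun x ↦ ‖K x‖) volume y]

theorem exists_norm_kernelConv_le (K : 𝓢(E, ℂ)) (hh : Integrable h)
    (h0 : ∀ x, 0 ≤ h x) (hgh : ∀ x, ‖g x‖ ≤ 1 + h x) : ∃ C, ∀ y, ‖kernelConv K g y‖ ≤ C := by
  obtain ⟨M, hM⟩ := exists_norm_le_schwartz K
  refine ⟨(∫ x, ‖K x‖) + M * ∫ x, h x, fun y ↦ ?_⟩
  have hK := ((K.integrable (μ := volume)).comp_sub_left y).norm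
  rw [← integral_const_mul, ← integral_sub_left_eq_self (fun x ↦ ‖K x‖) volume y,
    ← integral_add hK (hh.const_mul M)]
  exact norm_integral_le_of_norm_le (hK.add (hh.const_mul M))
    (ae_of_all _ (norm_kernel_smul_le hM h0 hgh y))

theorem integrable_prod_kernel_smul (K φ : 𝓢(E, ℂ)) (hg : AEStronglyMeasurable g)
    (hh : Integrable h) (h0 : ∀ x, 0 ≤ h x) (hgh : ∀ x, ‖g x‖ ≤ 1 + h x) :
    Integrable (fun z : E × E ↦ φ z.1 • K (z.1 - z.2) • g z.2)
      ((volume : Measure E).prod volume) := by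
  obtain ⟨M, hM⟩ := exists_norm_le_schwartz K
  -- The constant part of the majorant gives a convolution integrand of two `L¹` functions, the `h`
  -- part a plain product.
  have h1 : Integrable (fun z : E × E ↦ ‖φ z.1‖ * ‖K (z.1 - z.2)‖)
      ((volume : Measure E).prod volume) := by
    have hK : Integrable fun x ↦ ‖K (-x)‖ := (K.integrable (μ := volume)).norm.comp_neg
    have := ((φ.integrable (μ := volume)).norm.convolution_integrand (ContinuousLinearMap.mul ℝ ℝ) hK).swap
    simpa [Function.comp_def] using this
  have h2 : Integrable (fun z : E × E ↦ ‖φ z.1‖ * (M * h z.2))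
      ((volume : Measure E).prod volume) := φ.integrable.norm.mul_prod (hh.const_mul M)
  refine (h1.add h2).mono' ?_ (ae_of_all _ fun z ↦ ?_)
  · refine AEStronglyMeasurable.smul (Continuous.aestronglyMeasurable (by fun_prop)) ?_
    exact AEStronglyMeasurable.smul (Continuous.aestronglyMeasurable (by fun_prop)) hg.comp_snd
  · rw [norm_smul, Pi.add_apply, ← mul_add]
    gcongr
    exact norm_kernel_smul_le hM h0 hgh _ _

/-- Multipliers act on distributions by duality. On the test function the operator becomes
convolution with the reflected kernel, by Fubini for the integrable function `n ξ * φ y`. -/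
theorem fourier_smul_fourierInv_apply (n φ : 𝓢(E, ℂ)) (x : E) :
    𝓕 (SchwartzMap.smulLeftCLM ℂ n (𝓕⁻ φ)) x = ∫ y, φ y * (𝓕⁻ n) (y - x) := by
  have hi : Integrable (fun z : E × E ↦ n z.1 * φ z.2) ((volume : Measure E).prod volume) :=
    n.integrable.mul_prod φ.integrable
  have hi' : Integrable (Function.uncurry fun ξ y : E ↦
      Real.fourierChar (inner ℝ ξ (y - x)) • (n ξ * φ y)) ((volume : Measure E).prod volume) := by
    refine hi.mono ?_ (ae_of_all _ fun z ↦ ?_)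
    · exact Continuous.aestronglyMeasurable (by
        simp only [Function.uncurry_def, Circle.smul_def]
        fun_prop)
    · simp [Function.uncurry_def]
  calc 𝓕 (SchwartzMap.smulLeftCLM ℂ n (𝓕⁻ φ)) x
      = ∫ ξ, ∫ y, Real.fourierChar (inner ℝ ξ (y - x)) • (n ξ * φ y) := by
        rw [SchwartzMap.fourier_coe, Real.fourier_eq]
        refine integral_congr_ae (ae_of_all _ fun ξ ↦ ?_)
        beta_reduce
        rw [SchwartzMap.smulLeftCLM_apply_apply n.hasTemperateGrowth, SchwartzMap.fourierInv_coe,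
          Real.fourierInv_eq, smul_eq_mul, ← integral_const_mul,
          Circle.smul_def, smul_eq_mul, ← integral_const_mul]
        refine integral_congr_ae (ae_of_all _ fun y ↦ ?_)
        have hinner : inner ℝ ξ (y - x) = -inner ℝ ξ x + inner ℝ y ξ := by
          rw [inner_sub_right, real_inner_comm y ξ]
          ring
        simp only [Circle.smul_def, smul_eq_mul, hinner, AddChar.map_add_eq_mul, Circle.coe_mul]
        ring
    _ = ∫ y, ∫ ξ, Real.fourierChar (inner ℝ ξ (y - x)) • (n ξ * φ y) :=
        integral_integral_swap hi'
    _ = _ := by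
        refine integral_congr_ae (ae_of_all _ fun y ↦ ?_)
        beta_reduce
        rw [SchwartzMap.fourierInv_coe, Real.fourierInv_eq, ← integral_const_mul]
        refine integral_congr_ae (ae_of_all _ fun ξ ↦ ?_)
        simp only [Circle.smul_def, smul_eq_mul]
        ring

/-- A Fourier multiplier with Schwartz symbol `n` is the convolution with `𝓕⁻ n`. -/
theorem fourierMultiplierCLM_apply_eq_integral_kernelConv [CompleteSpace V] (n : 𝓢(E, ℂ))
    (hg : AEStronglyMeasurable g) (hh : Integrable h) (h0 : ∀ x, 0 ≤ h x)
    (hgh : ∀ x, ‖g x‖ ≤ 1 + h x) {u : 𝓢'(E, V)} (hu : ∀ φ : 𝓢(E, ℂ), u φ = ∫ x, φ x • g x)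
    (φ : 𝓢(E, ℂ)) :
    TemperedDistribution.fourierMultiplierCLM V n u φ =
      ∫ y, φ y • kernelConv (𝓕⁻ n : 𝓢(E, ℂ)) g y := by
  rw [TemperedDistribution.fourierMultiplierCLM_apply_apply, hu]
  have hi := integrable_prod_kernel_smul (𝓕⁻ n) φ hg hh h0 hgh
  calc ∫ x, 𝓕 (SchwartzMap.smulLeftCLM ℂ n (𝓕⁻ φ)) x • g x
      = ∫ x, ∫ y, φ y • (𝓕⁻ n) (y - x) • g x := by
        refine integral_congr_ae (ae_of_all _ fun x ↦ ?_)
        beta_reduce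
        rw [fourier_smul_fourierInv_apply, ← integral_smul_const]
        simp_rw [smul_smul]
    _ = ∫ y, ∫ x, φ y • (𝓕⁻ n) (y - x) • g x := (integral_integral_swap hi).symm
    _ = _ := by
        refine integral_congr_ae (ae_of_all _ fun y ↦ ?_)
        exact integral_smul _ _

end Kernel

/-! ### Plancherel and the `L²` endpoint -/

section Hilbert

variable {E V : Type*} [NormedAddCommGroup E] [InnerProductSpace ℝ E] [FiniteDimensional ℝ E]
  [MeasurableSpace E] [BorelSpace E] [NormedAddCommGroup V] [InnerProductSpace ℂ V]
  [CompleteSpace V]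

theorem lintegral_enorm_sq_Lp {F : Type*} [NormedAddCommGroup F] (f : Lp F 2 (volume : Measure E)) :
    ∫⁻ x, ‖f x‖ₑ ^ 2 = ‖f‖ₑ ^ 2 := by
  rw [Lp.enorm_def, eLpNorm_eq_lintegral_rpow_enorm_toReal two_ne_zero ENNReal.ofNat_ne_top]
  simp only [ENNReal.toReal_ofNat, one_div, ENNReal.rpow_ofNat]
  rw [← ENNReal.rpow_natCast, ← ENNReal.rpow_mul]
  simp

/-- Plancherel for the pointwise-defined convolution. Both `kernelConv (𝓕⁻ n) g` and the `L²`
function `𝓕⁻ (n • 𝓕 g)` represent the same tempered distribution, and both are locally integrable,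
so they agree almost everywhere. -/
theorem lintegral_enorm_kernelConv_sq (n : 𝓢(E, ℂ)) {g : E → V} (hg : MemLp g 2) :
    ∫⁻ y, ‖kernelConv (𝓕⁻ n : 𝓢(E, ℂ)) g y‖ₑ ^ 2 =
      ∫⁻ ξ, ‖n ξ‖ₑ ^ 2 * ‖(𝓕 hg.toLp : Lp V 2 (volume : Measure E)) ξ‖ₑ ^ 2 := by
  set G : Lp V 2 (volume : Measure E) := hg.toLp
  set N : Lp ℂ ∞ (volume : Measure E) := (n.memLp ∞ volume).toLp
  set W : Lp V 2 (volume : Measure E) := N • 𝓕 G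
  have hW : ((𝓕⁻ W : Lp V 2 (volume : Measure E)) : 𝓢'(E, V)) =
      TemperedDistribution.fourierMultiplierCLM V n (G : 𝓢'(E, V)) := by
    rw [← Lp.fourierInv_toTemperedDistribution_eq, TemperedDistribution.fourierMultiplierCLM_apply,
      Lp.fourier_toTemperedDistribution_eq]
    congr 1
    exact Lp.toTemperedDistribution_smul_eq n.hasTemperateGrowth (n.memLp ∞ volume) (𝓕 G)
  have hh : Integrable fun x ↦ ‖g x‖ ^ 2 := hg.integrable_norm_pow two_ne_zero
  have h0 (x : E) : 0 ≤ ‖g x‖ ^ 2 := by positivity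
  have hgh (x : E) : ‖g x‖ ≤ 1 + ‖g x‖ ^ 2 := by nlinarith [sq_nonneg (‖g x‖ - 1)]
  have hu (φ : 𝓢(E, ℂ)) : (G : 𝓢'(E, V)) φ = ∫ x, φ x • g x := by
    rw [Lp.toTemperedDistribution_apply]
    refine integral_congr_ae ?_
    filter_upwards [hg.coeFn_toLp] with x hx
    rw [hx]
  obtain ⟨C, hC⟩ := exists_norm_kernelConv_le (𝓕⁻ n) hh h0 hgh
  have hbdd : MemLp (kernelConv (𝓕⁻ n : 𝓢(E, ℂ)) g) ∞ :=
    memLp_top_of_bound (aestronglyMeasurable_kernelConv _ hg.1) C (ae_of_all _ hC)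
  have hae : kernelConv (𝓕⁻ n : 𝓢(E, ℂ)) g =ᵐ[volume] (𝓕⁻ W : Lp V 2 (volume : Measure E)) := by
    refine ae_eq_of_integral_contDiff_smul_eq (hbdd.locallyIntegrable le_top)
      ((Lp.memLp _).locallyIntegrable (by norm_num)) fun ψ hψ hψc ↦ ?_
    have hψ₁ : HasCompactSupport (Complex.ofRealCLM ∘ ψ) := hψc.comp_left rfl
    have hψ₂ : ContDiff ℝ ∞ (Complex.ofRealCLM ∘ ψ) := by fun_prop
    have h1 := fourierMultiplierCLM_apply_eq_integral_kernelConv n hg.1 hh h0 hgh hu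
      (hψ₁.toSchwartzMap hψ₂)
    rw [← hW, Lp.toTemperedDistribution_apply] at h1
    simpa using h1.symm
  calc ∫⁻ y, ‖kernelConv (𝓕⁻ n : 𝓢(E, ℂ)) g y‖ₑ ^ 2
      = ∫⁻ y, ‖(𝓕⁻ W : Lp V 2 (volume : Measure E)) y‖ₑ ^ 2 := by
        refine lintegral_congr_ae ?_
        filter_upwards [hae] with x hx
        rw [hx]
    _ = ∫⁻ ξ, ‖W ξ‖ₑ ^ 2 := by
        have : ‖(𝓕⁻ W : Lp V 2 (volume : Measure E))‖ₑ = ‖W‖ₑ := by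
          rw [← ofReal_norm, ← ofReal_norm, ← Lp.norm_fourier_eq, fourier_fourierInv_eq]
        rw [lintegral_enorm_sq_Lp, lintegral_enorm_sq_Lp, this]
    _ = _ := by
        refine lintegral_congr_ae ?_
        filter_upwards [Lp.coeFn_lpSMul (r := 2) N (𝓕 G), (n.memLp ∞ volume).coeFn_toLp]
          with ξ h1 h2
        rw [h1, Pi.smul_apply', h2, enorm_smul, mul_pow]

theorem tsum_lintegral_enorm_kernelConv_sq_le {ι : Type*} [Countable ι] {n : ι → 𝓢(E, ℂ)}
    {B : ℝ≥0∞} (hB : ∀ ξ, ∑' i, ‖n i ξ‖ₑ ^ 2 ≤ B) {g : E → V}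
    (hg : MemLp g 2) :
    ∑' i, ∫⁻ y, ‖kernelConv (𝓕⁻ (n i) : 𝓢(E, ℂ)) g y‖ₑ ^ 2 ≤ B * ∫⁻ x, ‖g x‖ₑ ^ 2 := by
  simp_rw [lintegral_enorm_kernelConv_sq _ hg]
  set G : Lp V 2 (volume : Measure E) := hg.toLp
  have hG : ‖(𝓕 G : Lp V 2 (volume : Measure E))‖ₑ = ‖G‖ₑ := by
    rw [← ofReal_norm, ← ofReal_norm, Lp.norm_fourier_eq]
  have hm : AEMeasurable fun ξ ↦ ‖(𝓕 G : Lp V 2 (volume : Measure E)) ξ‖ₑ ^ 2 :=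
    (Lp.aestronglyMeasurable _).enorm.pow_const 2
  have hn (i : ι) : AEMeasurable fun ξ ↦ ‖n i ξ‖ₑ ^ 2 := by
    have := (n i).continuous
    fun_prop
  calc ∑' i, ∫⁻ ξ, ‖n i ξ‖ₑ ^ 2 * ‖(𝓕 G : Lp V 2 (volume : Measure E)) ξ‖ₑ ^ 2
      = ∫⁻ ξ, (∑' i, ‖n i ξ‖ₑ ^ 2) * ‖(𝓕 G : Lp V 2 (volume : Measure E)) ξ‖ₑ ^ 2 := by
        simp_rw [← ENNReal.tsum_mul_right]
        exact (lintegral_tsum fun i ↦ (hn i).mul hm).symm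
    _ ≤ ∫⁻ ξ, B * ‖(𝓕 G : Lp V 2 (volume : Measure E)) ξ‖ₑ ^ 2 := by
        gcongr with ξ
        exact hB ξ
    _ = B * ∫⁻ ξ, ‖(𝓕 G : Lp V 2 (volume : Measure E)) ξ‖ₑ ^ 2 := lintegral_const_mul'' _ hm
    _ = B * ∫⁻ x, ‖g x‖ₑ ^ 2 := by
        rw [lintegral_enorm_sq_Lp, hG, ← lintegral_enorm_sq_Lp]
        congr 1
        refine lintegral_congr_ae ?_
        filter_upwards [hg.coeFn_toLp] with x hx
        rw [hx]

end Hilbert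

/-! ### The `ℓ^p(L^p)` bound for families of convolutions -/

section Interpolation

variable {E : Type*} [NormedAddCommGroup E] [InnerProductSpace ℝ E] [FiniteDimensional ℝ E]
  [MeasurableSpace E] [BorelSpace E]

theorem le_one_add_rpow {x p : ℝ} (hx : 0 ≤ x) (hp : 1 ≤ p) : x ≤ 1 + x ^ p := by
  rcases le_total x 1 with h | h
  · linarith [Real.rpow_nonneg hx p]
  · linarith [Real.self_le_rpow_of_one_le h hp]

/-- A family of convolutions whose kernels are bounded in `L¹` and whose symbols are
square-summable, uniformly in the frequency, is bounded from `L^p` to `ℓ^p(L^p)` if `2 ≤ p`. -/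
theorem exists_tsum_lintegral_kernelConv_rpow_le {ι : Type*} [Countable ι] (n : ι → 𝓢(E, ℂ))
    {A : ℝ} {B : NNReal} (hA : ∀ i, ∫ x, ‖(𝓕⁻ (n i) : 𝓢(E, ℂ)) x‖ ≤ A)
    (hB : ∀ ξ, ∑' i, ‖n i ξ‖ₑ ^ 2 ≤ B) {p : ℝ} (hp : 2 ≤ p)
    (V : Type*) [NormedAddCommGroup V] [InnerProductSpace ℂ V] [CompleteSpace V] :
    ∃ C : NNReal, ∀ g : E → V, MemLp g (ENNReal.ofReal p) →
      ∑' i, ∫⁻ y, ‖kernelConv (𝓕⁻ (n i) : 𝓢(E, ℂ)) g y‖ₑ ^ p ≤ C * ∫⁻ x, ‖g x‖ₑ ^ p := by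
  have hp0 : 0 < p := by linarith
  rcases hp.eq_or_lt with rfl | hp
  -- The endpoint `p = 2` is Plancherel itself; the interpolation constant `p / (p - 2)` is not
  -- available there.
  · refine ⟨B, fun g hg ↦ ?_⟩
    rw [ENNReal.ofReal_ofNat] at hg
    simpa using tsum_lintegral_enorm_kernelConv_sq_le hB hg
  -- The interpolation needs a strictly positive bound, which `A` need not be.
  · have hA' (i : ι) : ∫ x, ‖(𝓕⁻ (n i) : 𝓢(E, ℂ)) x‖ ≤ max A 1 := (hA i).trans (le_max_left _ _)
    set A' := max A 1
    have hA0 : 0 < A' := lt_max_of_lt_right one_pos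
    refine ⟨(ENNReal.ofReal ((2 * A') ^ p) * (B * ENNReal.ofReal ((A' ^ 2)⁻¹) *
        ENNReal.ofReal (p / (p - 2)))).toNNReal, fun g hg ↦ ?_⟩
    rw [ENNReal.coe_toNNReal (by finiteness)]
    have hint : Integrable fun x ↦ ‖g x‖ ^ p := by
      have := hg.integrable_norm_rpow (by simpa using hp0) ENNReal.ofReal_ne_top
      rwa [ENNReal.toReal_ofReal hp0.le] at this
    have h0 (x : E) : 0 ≤ ‖g x‖ ^ p := by positivity
    have hgh (x : E) : ‖g x‖ ≤ 1 + ‖g x‖ ^ p :=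
      le_one_add_rpow (norm_nonneg _) (by linarith)
    have hindh (s : Set E) (x : E) : ‖s.indicator g x‖ ≤ 1 + ‖g x‖ ^ p :=
      (norm_indicator_le_norm_self _ _).trans (hgh x)
    have hs₁ (t : ℝ) : NullMeasurableSet {x | ‖g x‖ ≤ t} :=
      nullMeasurableSet_le hg.1.norm.aemeasurable aemeasurable_const
    have hs₂ (t : ℝ) : NullMeasurableSet {x | t < ‖g x‖} :=
      nullMeasurableSet_lt aemeasurable_const hg.1.norm.aemeasurable
    have hm₁ (t : ℝ) : AEStronglyMeasurable ({x | ‖g x‖ ≤ t}.indicator g) :=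
      hg.1.indicator₀ (hs₁ t)
    have hm₂ (t : ℝ) : AEStronglyMeasurable ({x | t < ‖g x‖}.indicator g) :=
      hg.1.indicator₀ (hs₂ t)
    refine tsum_lintegral_enorm_rpow_le (T := fun i ↦ kernelConv (𝓕⁻ (n i) : 𝓢(E, ℂ))) hA0 hp hg.1
      (fun i ↦ aestronglyMeasurable_kernelConv _ hg.1) (fun t _ i y ↦ ?_) (fun t ht i y ↦ ?_)
      (fun t _ i ↦ aestronglyMeasurable_kernelConv _ (hm₂ t)) (fun t ht ↦ ?_)
    · rw [kernelConv, kernelConv, kernelConv, ← integral_add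
        (integrable_kernel_smul _ (hm₁ t) hint h0 (hindh _) y)
        (integrable_kernel_smul _ (hm₂ t) hint h0 (hindh _) y)]
      refine integral_congr_ae (ae_of_all _ fun x ↦ ?_)
      beta_reduce
      rw [← smul_add]
      congr 1
      rcases le_or_gt ‖g x‖ t with h | h
      · simp [Set.indicator, h, h.not_gt]
      · simp [Set.indicator, h, h.not_ge]
    · refine (norm_kernelConv_le (𝓕⁻ (n i)) (t := t) (fun x ↦ ?_) y).trans (by gcongr; exact hA' i)
      by_cases h : ‖g x‖ ≤ t
      · simp [Set.indicator, h]
      · simpa [Set.indicator, h] using ht.le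
    -- The truncation is in `L²` because `‖g‖² ≤ t^(2-p) ‖g‖^p` where `‖g‖ > t`.
    · have hmem : MemLp ({x | t < ‖g x‖}.indicator g) 2 := by
        rw [memLp_two_iff_integrable_sq_norm (hm₂ t)]
        refine (hint.const_mul (t ^ (2 - p))).mono' ((hm₂ t).norm.pow 2) (ae_of_all _ fun x ↦ ?_)
        by_cases h : t < ‖g x‖
        · have hx : 0 < ‖g x‖ := ht.trans h
          simp only [Set.indicator, Set.mem_ofPred_eq, h, if_true, norm_pow, norm_norm]
          calc ‖g x‖ ^ 2 = ‖g x‖ ^ (2 - p) * ‖g x‖ ^ p := by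
                rw [← Real.rpow_add hx, sub_add_cancel, Real.rpow_ofNat]
            _ ≤ _ := by
                gcongr ?_ * _
                exact Real.rpow_le_rpow_of_nonpos ht h.le (by linarith)
        · simp only [Set.indicator, Set.mem_ofPred_eq, h, if_false, norm_zero]
          norm_num
          positivity
      refine (tsum_lintegral_enorm_kernelConv_sq_le hB hmem).trans_eq ?_
      congr 1
      rw [← lintegral_indicator₀ (hs₂ t)]
      refine lintegral_congr fun x ↦ ?_
      by_cases h : t < ‖g x‖ <;> simp [Set.indicator, h]

end Interpolation

/-! ### Uniform `L¹` bounds for kernels -/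

section KernelBound

variable {E : Type*} [NormedAddCommGroup E] [InnerProductSpace ℝ E] [FiniteDimensional ℝ E]
  [MeasurableSpace E] [BorelSpace E]

/-- The map `a ↦ 𝓕⁻ a` is continuous from `𝓢` to `L¹`, so its norm is controlled by finitely many
Schwartz seminorms. -/
theorem exists_integral_norm_fourierInv_le : ∃ (s : Finset (ℕ × ℕ)) (C : NNReal),
    ∀ a : 𝓢(E, ℂ), ∫ x, ‖(𝓕⁻ a : 𝓢(E, ℂ)) x‖ ≤
      C * s.sup (schwartzSeminormFamily ℝ E ℂ) a := by
  set T : 𝓢(E, ℂ) →L[ℝ] Lp ℂ 1 (volume : Measure E) :=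
    SchwartzMap.toLpCLM ℝ ℂ 1 volume ∘L (fourierInvCLM ℝ 𝓢(E, ℂ))
  set q : Seminorm ℝ 𝓢(E, ℂ) := (normSeminorm ℝ (Lp ℂ 1 (volume : Measure E))).comp T.toLinearMap
  have hq : Continuous q := T.continuous.norm
  obtain ⟨s, C, -, h⟩ := Seminorm.bound_of_continuous (schwartz_withSeminorms ℝ E ℂ) q hq
  refine ⟨s, C, fun a ↦ ?_⟩
  have h1 : q a = ∫ x, ‖(𝓕⁻ a : 𝓢(E, ℂ)) x‖ := SchwartzMap.norm_toLp_one
  rw [← h1]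
  exact h a

/-- Derivatives of a section are restrictions of joint derivatives of `A`, which are bounded on the
compact set `closedBall 0 R ×ˢ Icc 0 1`. -/
theorem exists_seminorm_section_le {A : E × ℝ → ℂ} (hA : ContDiff ℝ ∞ A) {R : ℝ}
    (hR : ∀ ξ ε, R < ‖ξ‖ → A (ξ, ε) = 0) (k m : ℕ) :
    ∃ M : ℝ, 0 ≤ M ∧ ∀ ε ∈ Set.Icc (0 : ℝ) 1, ∀ a : 𝓢(E, ℂ), (∀ ξ, a ξ = A (ξ, ε)) →
      schwartzSeminormFamily ℝ E ℂ (k, m) a ≤ M := by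
  have hcpt : IsCompact (Metric.closedBall (0 : E) R ×ˢ Set.Icc (0 : ℝ) 1) :=
    (isCompact_closedBall _ _).prod isCompact_Icc
  obtain ⟨M, hM⟩ := hcpt.exists_bound_of_continuousOn
    (f := iteratedFDeriv ℝ m A) (hA.continuous_iteratedFDeriv (by exact_mod_cast le_top)).continuousOn
  refine ⟨|R| ^ k * |M|, by positivity, fun ε hε a ha ↦ ?_⟩
  refine SchwartzMap.seminorm_le_bound ℝ k m a (by positivity) fun ξ ↦ ?_
  by_cases hξ : ‖ξ‖ ≤ R
  -- The translation by `(0, ε)` is split off so that the remaining inclusion is linear, of norm at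
  -- most one.
  · have h1 : (a : E → ℂ) = (fun z ↦ A (z + (0, ε))) ∘ ContinuousLinearMap.inl ℝ E ℝ := by
      ext x
      simp [ha]
    have h2 : ContDiff ℝ ∞ fun z : E × ℝ ↦ A (z + (0, ε)) := by fun_prop
    have h3 : ‖iteratedFDeriv ℝ m a ξ‖ ≤ |M| := by
      rw [h1, (ContinuousLinearMap.inl ℝ E ℝ).iteratedFDeriv_comp_right h2 ξ
        (by exact_mod_cast le_top), iteratedFDeriv_comp_add_right]
      refine (ContinuousMultilinearMap.norm_compContinuousLinearMap_le _ _).trans ?_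
      have h4 : ∏ _i : Fin m, ‖ContinuousLinearMap.inl ℝ E ℝ‖ ≤ 1 :=
        Finset.prod_le_one (fun _ _ ↦ ContinuousLinearMap.opNorm_nonneg _)
          fun _ _ ↦ ContinuousLinearMap.norm_inl_le_one ℝ E ℝ
      have h5 := hM (ξ, ε) ⟨by simpa using hξ, hε⟩
      simp only [ContinuousLinearMap.inl_apply, Prod.mk_add_mk, add_zero, zero_add]
      calc _ ≤ ‖iteratedFDeriv ℝ m A (ξ, ε)‖ * 1 := by gcongr
        _ ≤ _ := by rw [mul_one]; exact h5.trans (le_abs_self M)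
    gcongr
    exact hξ.trans (le_abs_self R)
  · have hnot : ξ ∉ tsupport (iteratedFDeriv ℝ m a) := by
      intro h
      have h1 : tsupport (a : E → ℂ) ⊆ Metric.closedBall 0 R := by
        refine closure_minimal (fun x hx ↦ ?_) Metric.isClosed_closedBall
        by_contra hx'
        exact hx ((ha x).trans (hR x ε (by simpa using hx')))
      exact hξ (by simpa using h1 (tsupport_iteratedFDeriv_subset m h))
    rw [image_eq_zero_of_notMem_tsupport hnot]
    simp
    positivity

theorem exists_integral_norm_fourierInv_section_le {A : E × ℝ → ℂ} (hA : ContDiff ℝ ∞ A) {R : ℝ}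
    (hR : ∀ ξ ε, R < ‖ξ‖ → A (ξ, ε) = 0) :
    ∃ M : ℝ, ∀ ε ∈ Set.Icc (0 : ℝ) 1, ∀ a : 𝓢(E, ℂ), (∀ ξ, a ξ = A (ξ, ε)) →
      ∫ x, ‖(𝓕⁻ a : 𝓢(E, ℂ)) x‖ ≤ M := by
  obtain ⟨s, C, h⟩ := exists_integral_norm_fourierInv_le (E := E)
  choose M hM0 hM using exists_seminorm_section_le hA hR
  refine ⟨C * ∑ i ∈ s, M i.1 i.2, fun ε hε a ha ↦ (h a).trans ?_⟩
  gcongr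
  refine Seminorm.finset_sup_apply_le (Finset.sum_nonneg fun i _ ↦ hM0 _ _) fun i hi ↦ ?_
  exact (hM i.1 i.2 ε hε a ha).trans
    (Finset.single_le_sum (f := fun i : ℕ × ℕ ↦ M i.1 i.2) (fun i _ ↦ hM0 _ _) hi)

/-- The inverse transform of `a (c • ·)` is `c^{-d} (𝓕⁻ a)(c⁻¹ • ·)`, and this dilation preserves
the `L¹` norm. -/
theorem integral_norm_fourierInv_comp_smul {a b : 𝓢(E, ℂ)} {c : ℝ} (hc : 0 < c)
    (hab : ∀ ξ, b ξ = a (c • ξ)) :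
    ∫ x, ‖(𝓕⁻ b : 𝓢(E, ℂ)) x‖ = ∫ x, ‖(𝓕⁻ a : 𝓢(E, ℂ)) x‖ := by
  set D := |(c ^ Module.finrank ℝ E)⁻¹|
  have h1 (x : E) : (𝓕⁻ b : 𝓢(E, ℂ)) x = D • (𝓕⁻ a : 𝓢(E, ℂ)) (c⁻¹ • x) := by
    rw [SchwartzMap.fourierInv_coe, SchwartzMap.fourierInv_coe, Real.fourierInv_eq,
      Real.fourierInv_eq, ← Measure.integral_comp_smul]
    refine integral_congr_ae (ae_of_all _ fun ξ ↦ ?_)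
    beta_reduce
    rw [hab, inner_smul_left, inner_smul_right]
    simp [hc.ne']
  simp_rw [h1, norm_smul]
  rw [integral_const_mul, Measure.integral_comp_smul (μ := volume)
    (fun x ↦ ‖(𝓕⁻ a : 𝓢(E, ℂ)) x‖), smul_eq_mul, ← mul_assoc]
  have : ‖D‖ * |((c⁻¹) ^ Module.finrank ℝ E)⁻¹| = 1 := by
    simp only [D, Real.norm_eq_abs, abs_abs]
    rw [← abs_mul]
    have := (pow_pos hc (Module.finrank ℝ E)).ne'
    simp [this]
  rw [this, one_mul]

end KernelBound

/-! ### The symbols of the operators `T_i` -/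

noncomputable section Symbols

variable {E : Type*} [NormedAddCommGroup E] [InnerProductSpace ℝ E] [FiniteDimensional ℝ E]
  [MeasurableSpace E] [BorelSpace E] {Φ : E → ℝ}

/-- The symbol of a Littlewood-Paley block composed with a Bessel potential operator of
order `-α`, rescaled to frequencies of order one; `ε` is the inverse of the frequency. -/
def scaledSymbol (Φ : E → ℝ) (α : ℝ) (z : E × ℝ) : ℝ :=
  Φ z.1 * (z.2 ^ 2 + ‖z.1‖ ^ 2) ^ (-(α / 2))

/-- The power is singular only at `(0, 0)`, and `Φ` vanishes for `‖ξ‖ < 1/2`. -/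
theorem contDiff_scaledSymbol (hΦ : IsLittlewoodPaley Φ) (α : ℝ) :
    ContDiff ℝ ∞ (scaledSymbol Φ α) := by
  rw [contDiff_iff_contDiffAt]
  intro z
  by_cases hz : ‖z.1‖ < 1 / 2
  · have h : scaledSymbol Φ α =ᶠ[nhds z] fun _ ↦ 0 := by
      have hU : {w : E × ℝ | ‖w.1‖ < 1 / 2} ∈ nhds z :=
        (isOpen_lt (by fun_prop) continuous_const).mem_nhds hz
      filter_upwards [hU] with w hw
      have hw' : ‖w.1‖ < 1 / 2 := hw
      rw [scaledSymbol, hΦ.eq_zero fun h ↦ absurd h.1 hw'.not_ge, zero_mul]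
    exact contDiffAt_const.congr_of_eventuallyEq h
  · have hz1 : 0 < ‖z.1‖ := by linarith [not_lt.mp hz]
    have hne : z.2 ^ 2 + ‖z.1‖ ^ 2 ≠ 0 := by positivity
    refine ContDiffAt.mul (hΦ.contDiff.comp contDiff_fst).contDiffAt ?_
    refine ContDiffAt.rpow_const_of_ne ?_ hne
    exact ContDiff.contDiffAt ((contDiff_snd.pow 2).add ((contDiff_norm_sq ℝ).comp contDiff_fst))

theorem scaledSymbol_eq_zero (hΦ : IsLittlewoodPaley Φ) (α : ℝ) {ξ : E} (hξ : 2 < ‖ξ‖) (ε : ℝ) :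
    scaledSymbol Φ α (ξ, ε) = 0 := by
  rw [scaledSymbol, hΦ.eq_zero fun h ↦ absurd h.2 hξ.not_ge, zero_mul]

theorem IsLittlewoodPaley.le_one (hΦ : IsLittlewoodPaley Φ) (ξ : E) : Φ ξ ≤ 1 := by
  by_cases hξ : ξ = 0
  · rw [hξ, hΦ.eq_zero (by norm_num)]
    exact zero_le_one
  · have := le_hasSum (hΦ.hasSum ξ hξ) 0 fun j _ ↦ hΦ.nonneg _
    simpa using this

theorem IsLittlewoodPaley.tsum_ofReal_le_one (hΦ : IsLittlewoodPaley Φ) (ξ : E) :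
    ∑' j : ℕ, ENNReal.ofReal (Φ ((2 : ℝ) ^ (-((j : ℤ) + 1)) • ξ)) ≤ 1 := by
  by_cases hξ : ξ = 0
  · simp [hξ, hΦ.eq_zero (ξ := (0 : E)) (by norm_num)]
  · have h1 := ENNReal.tsum_comp_le_tsum_of_injective (f := fun j : ℕ ↦ (j : ℤ) + 1)
      (fun a b hab ↦ by simpa using hab) (fun j : ℤ ↦ ENNReal.ofReal (Φ ((2 : ℝ) ^ (-j) • ξ)))
    refine h1.trans ?_
    rw [← ENNReal.ofReal_tsum_of_nonneg (fun j ↦ hΦ.nonneg _) (hΦ.hasSum ξ hξ).summable,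
      (hΦ.hasSum ξ hξ).tsum_eq, ENNReal.ofReal_one]

theorem exists_scaledSymbol_sq_le (hΦ : IsLittlewoodPaley Φ) (α : ℝ) :
    ∃ M : NNReal, ∀ ξ, ∀ ε ∈ Set.Icc (0 : ℝ) 1,
      ENNReal.ofReal (scaledSymbol Φ α (ξ, ε) ^ 2) ≤ M * ENNReal.ofReal (Φ ξ) := by
  -- For `1/2 ≤ ‖ξ‖ ≤ 2` and `0 ≤ ε ≤ 1`, the base `ε² + ‖ξ‖²` lies in `[1/4, 5]`. One factor `Φ`
  -- survives since `Φ² ≤ Φ`.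
  have hc : ContinuousOn (fun x : ℝ ↦ x ^ (-(α / 2))) (Set.Icc (1 / 4) 5) := fun x hx ↦
    (Real.continuousAt_rpow_const _ _ (Or.inl (by linarith [hx.1]))).continuousWithinAt
  obtain ⟨M, hM⟩ := isCompact_Icc.exists_bound_of_continuousOn hc
  refine ⟨(M ^ 2).toNNReal, fun ξ ε hε ↦ ?_⟩
  change _ ≤ ENNReal.ofReal (M ^ 2) * _
  rw [← ENNReal.ofReal_mul (by positivity)]
  refine ENNReal.ofReal_le_ofReal ?_
  by_cases hξ : 1 / 2 ≤ ‖ξ‖ ∧ ‖ξ‖ ≤ 2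
  · have h1 := hM (ε ^ 2 + ‖ξ‖ ^ 2) ⟨by nlinarith [hξ.1, sq_nonneg ε],
      by nlinarith [hξ.1, hξ.2, hε.1, hε.2]⟩
    rw [Real.norm_eq_abs] at h1
    have h2 : ((ε ^ 2 + ‖ξ‖ ^ 2) ^ (-(α / 2))) ^ 2 ≤ M ^ 2 := by
      rw [← sq_abs]
      gcongr
    have h3 : Φ ξ ^ 2 ≤ Φ ξ := by
      nlinarith [hΦ.nonneg ξ, hΦ.le_one ξ]
    rw [scaledSymbol, mul_pow, mul_comm]
    gcongr
  · simp [scaledSymbol, hΦ.eq_zero hξ]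

/-- The symbol of `S_0 (1 - Δ)^{-α/2}`, as a Schwartz function in Mathlib's frequency variable. -/
def lowSchwartz (hΦ : IsLittlewoodPaley Φ) (α : ℝ) : 𝓢(E, ℂ) :=
  HasCompactSupport.toSchwartzMap
    (f := fun ξ : E ↦ ((lowSymbol Φ ((2 * Real.pi) • ξ) : ℝ) : ℂ) *
      (((1 + ‖(2 * Real.pi) • ξ‖ ^ 2) ^ (-α / 2) : ℝ) : ℂ))
    (((hΦ.hasCompactSupport_lowSymbol.comp_smul
      (c := 2 * Real.pi) (by positivity)).comp_left (g := ((↑) : ℝ → ℂ)) rfl).mul_right)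
    ((Complex.ofRealCLM.contDiff.comp (hΦ.contDiff_lowSymbol.comp (contDiff_const_smul _))).mul
      (hasTemperateGrowth_bessel (-α)).1)

/-- The function `ξ ↦ scaledSymbol Φ α (c • ξ, ε)` as a Schwartz function. -/
def blockSchwartz (hΦ : IsLittlewoodPaley Φ) (α ε : ℝ) {c : ℝ} (hc : 0 < c) : 𝓢(E, ℂ) :=
  HasCompactSupport.toSchwartzMap
    (f := fun ξ : E ↦ ((scaledSymbol Φ α (c • ξ, ε) : ℝ) : ℂ))
    (((HasCompactSupport.of_support_subset_isCompact (f := fun ξ : E ↦ scaledSymbol Φ α (ξ, ε))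
      (isCompact_closedBall (0 : E) 2) (fun ξ hξ ↦ by
        by_contra h
        exact hξ (scaledSymbol_eq_zero hΦ α (by simpa using h) ε))).comp_smul hc.ne').comp_left
          (g := ((↑) : ℝ → ℂ)) rfl)
    (Complex.ofRealCLM.contDiff.comp ((contDiff_scaledSymbol hΦ α).comp (by fun_prop)))

/-- The symbols of `S_0 (1 - Δ)^{-α/2}` and of `2^{jα} Δ_j (1 - Δ)^{-α/2}` for `j ≥ 1`. -/
def besovSymbol (hΦ : IsLittlewoodPaley Φ) (α : ℝ) : ℕ → 𝓢(E, ℂ)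
  | 0 => lowSchwartz hΦ α
  | j + 1 => blockSchwartz hΦ α ((2 : ℝ) ^ (-((j : ℤ) + 1)))
      (c := (2 : ℝ) ^ (-((j : ℤ) + 1)) * (2 * Real.pi)) (by positivity)

theorem besovSymbol_zero_apply (hΦ : IsLittlewoodPaley Φ) (α : ℝ) (ξ : E) :
    besovSymbol hΦ α 0 ξ = (lowSymbol Φ ((2 * Real.pi) • ξ) : ℂ) *
      (((1 + ‖(2 * Real.pi) • ξ‖ ^ 2) ^ (-α / 2) : ℝ) : ℂ) := rfl

theorem besovSymbol_succ_apply (hΦ : IsLittlewoodPaley Φ) (α : ℝ) (j : ℕ) (ξ : E) :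
    besovSymbol hΦ α (j + 1) ξ = (scaledSymbol Φ α ((2 : ℝ) ^ (-((j : ℤ) + 1)) •
      (2 * Real.pi) • ξ, (2 : ℝ) ^ (-((j : ℤ) + 1))) : ℂ) := by
  rw [smul_smul]
  rfl

theorem two_zpow_neg_mem_Icc (j : ℕ) : (2 : ℝ) ^ (-((j : ℤ) + 1)) ∈ Set.Icc (0 : ℝ) 1 :=
  ⟨by positivity, zpow_le_one_of_nonpos₀ one_le_two (by omega)⟩

theorem exists_integral_norm_besovSymbol_le (hΦ : IsLittlewoodPaley Φ) (α : ℝ) :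
    ∃ A : ℝ, ∀ i, ∫ x, ‖(𝓕⁻ (besovSymbol hΦ α i) : 𝓢(E, ℂ)) x‖ ≤ A := by
  obtain ⟨M, hM⟩ := exists_integral_norm_fourierInv_section_le (R := 2)
    (A := fun z : E × ℝ ↦ ((scaledSymbol Φ α z : ℝ) : ℂ))
    (Complex.ofRealCLM.contDiff.comp (contDiff_scaledSymbol hΦ α))
    (fun ξ ε hξ ↦ by simp [scaledSymbol_eq_zero hΦ α hξ])
  refine ⟨max (∫ x, ‖(𝓕⁻ (besovSymbol hΦ α 0) : 𝓢(E, ℂ)) x‖) M, fun i ↦ ?_⟩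
  rcases i with _ | j
  · exact le_max_left _ _
  · refine le_trans ?_ (le_max_right _ _)
    -- Undoing the dilation leaves a section of `scaledSymbol` at `ε = 2^{-(j+1)}`, to which the
    -- uniform bound applies.
    rw [integral_norm_fourierInv_comp_smul (c := (2 : ℝ) ^ (-((j : ℤ) + 1)) * (2 * Real.pi))
      (a := blockSchwartz hΦ α ((2 : ℝ) ^ (-((j : ℤ) + 1))) one_pos) (by positivity)
      (fun ξ ↦ by simp [besovSymbol, blockSchwartz])]
    exact hM _ (two_zpow_neg_mem_Icc j) _ fun ξ ↦ by simp [blockSchwartz]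

theorem exists_tsum_enorm_besovSymbol_sq_le (hΦ : IsLittlewoodPaley Φ) (α : ℝ) :
    ∃ B : NNReal, ∀ ξ, ∑' i, ‖besovSymbol hΦ α i ξ‖ₑ ^ 2 ≤ B := by
  obtain ⟨M₀, hM₀⟩ := exists_norm_le_schwartz (besovSymbol hΦ α 0)
  obtain ⟨M, hM⟩ := exists_scaledSymbol_sq_le hΦ α
  refine ⟨M₀.toNNReal ^ 2 + M, fun ξ ↦ ?_⟩
  rw [tsum_eq_zero_add' ENNReal.summable]
  push_cast
  gcongr
  · rw [← ofReal_norm]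
    exact ENNReal.ofReal_le_ofReal (hM₀ ξ)
  · calc ∑' j : ℕ, ‖besovSymbol hΦ α (j + 1) ξ‖ₑ ^ 2
        ≤ ∑' j : ℕ, M * ENNReal.ofReal (Φ ((2 : ℝ) ^ (-((j : ℤ) + 1)) • (2 * Real.pi) • ξ)) := by
          refine ENNReal.tsum_le_tsum fun j ↦ ?_
          refine le_trans (le_of_eq ?_) (hM _ _ (two_zpow_neg_mem_Icc j))
          rw [← ofReal_norm, ← ENNReal.ofReal_pow (norm_nonneg _)]
          simp [besovSymbol_succ_apply]
      _ ≤ M * 1 := by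
          rw [ENNReal.tsum_mul_left]
          gcongr
          exact hΦ.tsum_ofReal_le_one _
      _ = M := mul_one _

theorem lowSymbol_eq_bessel_mul (hΦ : IsLittlewoodPaley Φ) (α : ℝ) :
    (fun ξ : E ↦ (lowSymbol Φ ((2 * Real.pi) • ξ) : ℂ)) =
      (fun ξ : E ↦ (((1 + ‖(2 * Real.pi) • ξ‖ ^ 2) ^ (α / 2) : ℝ) : ℂ)) * besovSymbol hΦ α 0 := by
  ext ξ
  have h : (0 : ℝ) < 1 + ‖(2 * Real.pi) • ξ‖ ^ 2 := by positivity
  rw [Pi.mul_apply, besovSymbol_zero_apply, ← Complex.ofReal_mul, ← Complex.ofReal_mul]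
  congr 1
  rw [mul_left_comm, ← Real.rpow_add h, ← add_div, add_neg_cancel, zero_div, Real.rpow_zero,
    mul_one]

/-- With `ε = 2^{-(j+1)}`, homogeneity `ε² + ‖ε η‖² = ε² (1 + ‖η‖²)` turns the scaled power into
`ε^{-α} (1 + ‖η‖²)^{-α/2}`; the factor in front cancels `ε^{-α}`. -/
theorem blockSymbol_eq_bessel_mul (hΦ : IsLittlewoodPaley Φ) (α : ℝ) (j : ℕ) :
    (fun ξ : E ↦ (Φ ((2 : ℝ) ^ (-((j : ℤ) + 1)) • (2 * Real.pi) • ξ) : ℂ)) =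
      (((2 : ℝ) ^ (-((j : ℝ) + 1) * α) : ℝ) : ℂ) •
        ((fun ξ : E ↦ (((1 + ‖(2 * Real.pi) • ξ‖ ^ 2) ^ (α / 2) : ℝ) : ℂ)) *
          besovSymbol hΦ α (j + 1)) := by
  ext ξ
  have h : (0 : ℝ) < 1 + ‖(2 * Real.pi) • ξ‖ ^ 2 := by positivity
  have hε : (0 : ℝ) < (2 : ℝ) ^ (-((j : ℤ) + 1)) := by positivity
  have hε' : (2 : ℝ) ^ (-((j : ℝ) + 1) * α) = ((2 : ℝ) ^ (-((j : ℤ) + 1))) ^ α := by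
    rw [← Real.rpow_intCast, ← Real.rpow_mul zero_le_two]
    push_cast
    rfl
  rw [hε']
  rw [Pi.smul_apply, Pi.mul_apply, besovSymbol_succ_apply, smul_eq_mul, ← Complex.ofReal_mul,
    ← Complex.ofReal_mul, scaledSymbol]
  congr 1
  generalize (2 : ℝ) ^ (-((j : ℤ) + 1)) = ε at hε
  generalize (2 * Real.pi) • ξ = η at h
  have h1 : ε ^ 2 + ‖ε • η‖ ^ 2 = ε ^ 2 * (1 + ‖η‖ ^ 2) := by
    rw [norm_smul, mul_pow, Real.norm_eq_abs, sq_abs]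
    ring
  have h2 : (ε ^ 2) ^ (-(α / 2)) = ε ^ (-α) := by
    rw [← Real.rpow_natCast, ← Real.rpow_mul hε.le]
    congr 1
    push_cast
    ring
  rw [h1, Real.mul_rpow (by positivity) h.le, h2, Real.rpow_neg hε.le, Real.rpow_neg h.le]
  have h3 := (Real.rpow_pos_of_pos hε α).ne'
  have h4 := (Real.rpow_pos_of_pos h (α / 2)).ne'
  field_simp

end Symbols

/-! ### The embedding -/

section Embedding

variable {E V : Type*} [NormedAddCommGroup E] [InnerProductSpace ℝ E] [FiniteDimensional ℝ E]
  [MeasurableSpace E] [BorelSpace E] [NormedAddCommGroup V]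

/-- Any representing function competes in the infimum; if its norm is infinite the bound is trivial,
so `MemLp` need not be known beforehand. -/
theorem lpENorm_rpow_le [NormedSpace ℂ V] {p : ℝ} (hp : 0 < p) {u : 𝓢'(E, V)} {G : E → V}
    (hG : AEStronglyMeasurable G) (hu : ∀ φ : 𝓢(E, ℂ), u φ = ∫ x, φ x • G x) :
    lpENorm p u ^ p ≤ ∫⁻ x, ‖G x‖ₑ ^ p := by
  have heq : eLpNorm G (ENNReal.ofReal p) volume ^ p = ∫⁻ x, ‖G x‖ₑ ^ p := by
    rw [eLpNorm_eq_lintegral_rpow_enorm_toReal (by simpa using hp) ENNReal.ofReal_ne_top,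
      ENNReal.toReal_ofReal hp.le, ← ENNReal.rpow_mul, one_div, inv_mul_cancel₀ hp.ne',
      ENNReal.rpow_one]
  by_cases htop : eLpNorm G (ENNReal.ofReal p) volume = ⊤
  · rw [← heq, htop, ENNReal.top_rpow_of_pos hp]
    exact le_top
  · rw [← heq]
    gcongr
    exact iInf₂_le_of_le G ⟨hG, lt_top_iff_ne_top.mpr htop⟩ (iInf_le _ hu)

theorem exists_besovENorm_le_sobolevENorm {Φ : E → ℝ} (hΦ : IsLittlewoodPaley Φ) (α : ℝ) {p : ℝ}
    (hp : 2 ≤ p) (V : Type*) [NormedAddCommGroup V] [InnerProductSpace ℂ V] [CompleteSpace V] :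
    ∃ C : NNReal, 0 < C ∧ ∀ f : 𝓢'(E, V), besovENorm Φ α p f ≤ C * sobolevENorm α p f := by
  have hp0 : 0 < p := by linarith
  obtain ⟨A, hA⟩ := exists_integral_norm_besovSymbol_le hΦ α
  obtain ⟨B, hB⟩ := exists_tsum_enorm_besovSymbol_sq_le hΦ α
  obtain ⟨C, hC⟩ := exists_tsum_lintegral_kernelConv_rpow_le (besovSymbol hΦ α) hA hB hp V
  -- The factor `2` pays for the two summands of the Besov norm, each bounded by the full `ℓ^p(L^p)`
  -- norm; `C + 1` keeps the constant positive.
  set D : NNReal := 2 * (C + 1) ^ (1 / p)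
  have hD : 0 < D := by positivity
  refine ⟨D, hD, fun f ↦ ?_⟩
  -- Moving `D` inside the infima reduces to one `g` representing `bessel α f`. If there is none,
  -- the right-hand side is `∞`.
  rw [sobolevENorm, lpENorm, ENNReal.mul_iInf_of_ne (by exact_mod_cast hD.ne') (by finiteness)]
  refine le_iInf fun g ↦ ?_
  rw [ENNReal.mul_iInf_of_ne (by exact_mod_cast hD.ne') (by finiteness)]
  refine le_iInf fun hg ↦ ?_
  rw [ENNReal.mul_iInf_of_ne (by exact_mod_cast hD.ne') (by finiteness)]
  refine le_iInf fun hu ↦ ?_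
  set T : ℕ → E → V := fun i ↦ kernelConv (𝓕⁻ (besovSymbol hΦ α i) : 𝓢(E, ℂ)) g
  have hT (i : ℕ) : AEStronglyMeasurable (T i) := aestronglyMeasurable_kernelConv _ hg.1
  have hint : Integrable fun x ↦ ‖g x‖ ^ p := by
    have := hg.integrable_norm_rpow (by simpa using hp0) ENNReal.ofReal_ne_top
    rwa [ENNReal.toReal_ofReal hp0.le] at this
  have hrep (i : ℕ) (φ : 𝓢(E, ℂ)) :
      TemperedDistribution.fourierMultiplierCLM V (besovSymbol hΦ α i) (bessel α f) φ =
        ∫ y, φ y • T i y :=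
    fourierMultiplierCLM_apply_eq_integral_kernelConv _ hg.1 hint (fun x ↦ by positivity)
      (fun x ↦ le_one_add_rpow (norm_nonneg _) (by linarith)) hu φ
  have hlow : lpENorm p (lowPart Φ f) ^ p ≤ ∫⁻ x, ‖T 0 x‖ₑ ^ p := by
    refine lpENorm_rpow_le hp0 (hT 0) fun φ ↦ ?_
    rw [← hrep, bessel, multiplier, TemperedDistribution.fourierMultiplierCLM_fourierMultiplierCLM_apply
      (hasTemperateGrowth_bessel α) (besovSymbol hΦ α 0).hasTemperateGrowth,
      ← lowSymbol_eq_bessel_mul]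
    rfl
  have hblock (j : ℕ) : ENNReal.ofReal ((2 : ℝ) ^ (((j : ℝ) + 1) * α * p)) *
      -- The block is represented by `r • T (j + 1)`, and `r ^ p` cancels the Besov weight exactly.
      lpENorm p (block Φ ((j : ℤ) + 1) f) ^ p ≤ ∫⁻ x, ‖T (j + 1) x‖ₑ ^ p := by
    set r : ℝ := (2 : ℝ) ^ (-((j : ℝ) + 1) * α)
    have hr : 0 < r := by positivity
    have h1 : lpENorm p (block Φ ((j : ℤ) + 1) f) ^ p ≤ ∫⁻ x, ‖(r : ℂ) • T (j + 1) x‖ₑ ^ p := by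
      refine lpENorm_rpow_le hp0 ((hT _).const_smul _) fun φ ↦ ?_
      have h2 : block Φ ((j : ℤ) + 1) f = (r : ℂ) •
          TemperedDistribution.fourierMultiplierCLM V (besovSymbol hΦ α (j + 1)) (bessel α f) := by
        rw [bessel, multiplier,
          TemperedDistribution.fourierMultiplierCLM_fourierMultiplierCLM_apply
            (hasTemperateGrowth_bessel α) (besovSymbol hΦ α (j + 1)).hasTemperateGrowth, block,
          multiplier, blockSymbol_eq_bessel_mul hΦ α j,
          TemperedDistribution.fourierMultiplierCLM_smul
            ((hasTemperateGrowth_bessel α).mul (besovSymbol hΦ α (j + 1)).hasTemperateGrowth)]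
        rfl
      have h3 : (block Φ ((j : ℤ) + 1) f) φ = (r : ℂ) • ∫ y, φ y • T (j + 1) y := by
        rw [h2, ← hrep]
        rfl
      rw [h3, ← integral_smul]
      refine integral_congr_ae (ae_of_all _ fun y ↦ ?_)
      exact smul_comm _ _ _
    have h4 (x : E) : ‖(r : ℂ) • T (j + 1) x‖ₑ ^ p =
        ENNReal.ofReal (r ^ p) * ‖T (j + 1) x‖ₑ ^ p := by
      rw [enorm_smul, ENNReal.mul_rpow_of_nonneg _ _ hp0.le, ← ofReal_norm, Complex.norm_real,
        Real.norm_of_nonneg hr.le, ENNReal.ofReal_rpow_of_pos hr]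
    have h5 : ENNReal.ofReal ((2 : ℝ) ^ (((j : ℝ) + 1) * α * p)) * ENNReal.ofReal (r ^ p) = 1 := by
      rw [← ENNReal.ofReal_mul (by positivity), ← Real.rpow_mul zero_le_two,
        ← Real.rpow_add zero_lt_two]
      ring_nf
      simp
    calc _ ≤ ENNReal.ofReal ((2 : ℝ) ^ (((j : ℝ) + 1) * α * p)) *
          ∫⁻ x, ‖(r : ℂ) • T (j + 1) x‖ₑ ^ p := by gcongr
      _ = _ := by
        simp_rw [h4]
        rw [lintegral_const_mul' _ _ ENNReal.ofReal_ne_top, ← mul_assoc, h5, one_mul]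
  have hsum := hC g hg
  rw [tsum_eq_zero_add' ENNReal.summable] at hsum
  have hS : (C * ∫⁻ x, ‖g x‖ₑ ^ p) ^ (1 / p) ≤
      ((C + 1 : NNReal) : ℝ≥0∞) ^ (1 / p) * eLpNorm g (ENNReal.ofReal p) volume := by
    rw [eLpNorm_eq_lintegral_rpow_enorm_toReal (by simpa using hp0) ENNReal.ofReal_ne_top,
      ENNReal.toReal_ofReal hp0.le, ← ENNReal.mul_rpow_of_nonneg _ _ (by positivity)]
    gcongr
    exact le_self_add
  have h1 : lpENorm p (lowPart Φ f) ≤ (C * ∫⁻ x, ‖g x‖ₑ ^ p) ^ (1 / p) := by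
    rw [one_div, ENNReal.le_rpow_inv_iff hp0]
    exact hlow.trans (le_self_add.trans hsum)
  have h2 : (∑' j : ℕ, ENNReal.ofReal ((2 : ℝ) ^ (((j : ℝ) + 1) * α * p)) *
      lpENorm p (block Φ ((j : ℤ) + 1) f) ^ p) ^ (1 / p) ≤ (C * ∫⁻ x, ‖g x‖ₑ ^ p) ^ (1 / p) := by
    gcongr
    exact (ENNReal.tsum_le_tsum hblock).trans (le_add_self.trans hsum)
  calc besovENorm Φ α p f ≤ _ := add_le_add (h1.trans hS) (h2.trans hS)
    _ = _ := by
      rw [← two_mul, ← mul_assoc, ENNReal.coe_mul, ENNReal.coe_rpow_of_nonneg _ (by positivity)]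
      norm_num

theorem exists_memBesov_and_besovENorm_le {Φ : E → ℝ} (hΦ : IsLittlewoodPaley Φ) (α : ℝ) {p : ℝ}
    (hp : 2 ≤ p) (V : Type*) [NormedAddCommGroup V] [InnerProductSpace ℂ V] [CompleteSpace V] :
    ∃ C : NNReal, 0 < C ∧ ∀ f : 𝓢'(E, V), MemSobolev α p f →
      MemBesov Φ α p f ∧ besovENorm Φ α p f ≤ C * sobolevENorm α p f := by
  obtain ⟨C, hC, h⟩ := exists_besovENorm_le_sobolevENorm hΦ α hp V
  exact ⟨C, hC, fun f hf ↦ ⟨(h f).trans_lt (ENNReal.mul_lt_top ENNReal.coe_lt_top hf), h f⟩⟩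

end Embedding

end VectorBesov

/-! ### The real and complex cases -/

theorem mainTheorem4 (d : ℕ) (hd : 0 < d) (Φ : EuclideanSpace ℝ (Fin d) → ℝ)
    (hΦ : VectorBesov.IsLittlewoodPaley Φ) (α p : ℝ) (hp : 2 ≤ p) :
    (∀ (V : Type*) [NormedAddCommGroup V] [InnerProductSpace ℝ V] [CompleteSpace V]
        [TopologicalSpace.SeparableSpace V],
      ∃ C : NNReal, 0 < C ∧ ∀ f : 𝓢(EuclideanSpace ℝ (Fin d), ℝ) →Lₚₜ[ℝ] V,
        VectorBesov.MemSobolev α p (VectorBesov.complexify f) →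
          VectorBesov.MemBesov Φ α p (VectorBesov.complexify f) ∧
          VectorBesov.besovENorm Φ α p (VectorBesov.complexify f) ≤
            C * VectorBesov.sobolevENorm α p (VectorBesov.complexify f)) ∧
    (∀ (V : Type*) [NormedAddCommGroup V] [InnerProductSpace ℂ V] [CompleteSpace V]
        [TopologicalSpace.SeparableSpace V],
      ∃ C : NNReal, 0 < C ∧ ∀ f : 𝓢'(EuclideanSpace ℝ (Fin d), V),
        VectorBesov.MemSobolev α p f →
          VectorBesov.MemBesov Φ α p f ∧
          VectorBesov.besovENorm Φ α p f ≤ C * VectorBesov.sobolevENorm α p f) := by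
  refine ⟨fun V _ _ _ _ ↦ ?_, fun V _ _ _ _ ↦ ?_⟩
  -- The real case is the complex one for the Hilbert space `Complexification V`.
  · obtain ⟨C, hC, h⟩ := VectorBesov.exists_memBesov_and_besovENorm_le hΦ α hp (Complexification V)
    exact ⟨C, hC, fun f hf ↦ h _ hf⟩
  · exact VectorBesov.exists_memBesov_and_besovENorm_le hΦ α hp V
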